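/- Let $d\ge 2$ and let $q_1,\dots,q_d\ge 2$ be integers. For each $q\in\{q_1,\dots,q_d\}$ let $T_q$ be the homogeneous tree in which every vertex has degree $q+1$, with a chosen end $\omega_q$ and a chosen origin $o_q$. (A ray is an isometric embedding of the half-line; two rays are equivalent if the symmetric difference of their vertex sets is finite; an end is an equivalence class of rays.) A vertex $z$ is an ancestor of $x$ if it lies on the ray that starts at $x$ and represents $\omega_q$. Let $x\curlywedge y$ be the maximal common ancestor of $x$ and $y$, and let $\mathfrak h(x)=d(x,x\curlywedge o_q)-d(o_q,x\curlywedge o_q)$ be the Busemann function. The affine group $\mathrm{Aff}(T_q)$ is the stabilizer of $\omega_q$ in $\mathrm{Aut}(T_q)$; for $g\in\mathrm{Aff}(T_q)$ the difference $\mathfrak h(gx)-\mathfrak h(x)$ does not depend on the vertex $x$ and is denoted by $\mathfrak h(g)$. The graph $DL=DL(q_1,\dots,q_d)$ has as vertices the tuples $x=x_1\cdots x_d$ with $x_j\in T_{q_j}$ and $\mathfrak h(x_1)+\dots+\mathfrak h(x_d)=0$; two vertices $x,y$ are neighbours if there are $i\ne j$ such that $x_i\sim y_i$, $x_j\sim y_j$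 and $x_k=y_k$ for all $k\ne i,j$. Let $$\mathcal A=\Bigl\{g_1\cdots g_d\in\prod_{j=1}^d\mathrm{Aff}(T_{q_j}) : \mathfrak h(g_1)+\dots+\mathfrak h(g_d)=0\Bigr\},$$ acting on $DL$ by $(gx)_j=g_jx_j$, and let $\mathfrak S$ be the group of all permutations $\sigma$ of $\{1,\dots,d\}$ with $q_{\sigma(j)}=q_j$ for all $j$, acting on $DL$ by $(\sigma x)_j=x_{\sigma^{-1}(j)}$ and on $\mathcal A$ by the automorphisms $g\mapsto g^\sigma$, $(g^\sigma)_j=g_{\sigma^{-1}(j)}$. Then the full isometry (automorphism) group of $DL$ is the semidirect product $$\mathrm{Aut}(DL)=\mathfrak S\ltimes\mathcal A$$ with respect to the action $(\sigma,g)\mapsto g^\sigma$; that is, $(g,\sigma)\mapsto\bigl(x\mapsto g(\sigma x)\bigr)$ is an isomorphism of this semidirect product onto $\mathrm{Aut}(DL)$. With the topology of pointwise convergence, $\mathrm{Aut}(DL)$ is a locally compact topological group; it is amenable (there is a finitely additive, left-invariant probability measure on its Borel sets which vanishes on the sets of Haar measure zero), and it is unimodular (its left Haar measure is right-invariant) if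 and only if $q_1=\dots=q_d$. -/

import Mathlib

open MeasureTheory
open scoped ENNReal

namespace DiestelLeader

universe u

section Groups

/-- Amenability of a (locally compact) topological group: there is a finitely additive,
left-invariant probability measure on the Borel sets which vanishes on the sets of Haar measure
zero (equivalently, a left-invariant mean on the essentially bounded functions). -/
def IsAmenableGroup (G : Type*) [Group G] [TopologicalSpace G] : Prop :=
  letI : MeasurableSpace G := borel G
  ∃ m : Set G → ℝ≥0∞,
    m Set.univ = 1 ∧
    (∀ A B : Set G, MeasurableSet A → MeasurableSet B → Disjoint A B →
      m (A ∪ B) = m A + m B) ∧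
    (∀ (g : G) (A : Set G), MeasurableSet A → m ((fun h => g * h) ⁻¹' A) = m A) ∧
    (∀ μ : Measure G, μ.IsHaarMeasure → μ.Regular →
      ∀ A : Set G, MeasurableSet A → μ A = 0 → m A = 0)

/-- Unimodularity of a (locally compact) topological group: there is a left Haar measure which is
also right-invariant. -/
def IsUnimodularGroup (G : Type*) [Group G] [TopologicalSpace G] : Prop :=
  letI : MeasurableSpace G := borel G
  ∃ μ : Measure G, μ.IsHaarMeasure ∧ μ.Regular ∧ μ.IsMulRightInvariant

end Groups

/-- The automorphism group `T ≃g T` of a graph carries the topology of pointwise convergence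
(the vertex set being discrete). -/
instance graphAutTopology {V : Type*} (T : SimpleGraph V) : TopologicalSpace (T ≃g T) :=
  TopologicalSpace.induced (fun g : T ≃g T => (g : V → V))
    (@Pi.topologicalSpace V (fun _ => V) (fun _ => ⊥))

section Ends

variable {V : Type*} (T : SimpleGraph V)

/-- A geodesic ray: an isometric embedding of the half-line into the graph. -/
structure Ray where
  toFun : ℕ → V
  geodesic : ∀ m n, T.dist (toFun m) (toFun (m + n)) = n

/-- Two rays are equivalent if the symmetric difference of their vertex sets is finite. -/
instance rayEquiv : Setoid (Ray T) where
  r r s := (symmDiff (Set.range r.toFun) (Set.range s.toFun)).Finite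
  iseqv :=
    { refl := fun r => by simp
      symm := fun {r s} h => by rwa [symmDiff_comm]
      trans := fun {r s t} h h' => (h.union h').subset
        (symmDiff_triangle (Set.range r.toFun) (Set.range s.toFun) (Set.range t.toFun)) }

/-- An end is an equivalence class of rays. -/
def TreeEnd : Type _ := Quotient (rayEquiv T)

variable {T}

theorem dist_iso (g : T ≃g T) (x y : V) : T.dist (g x) (g y) = T.dist x y := by
  have key : ∀ (h : T ≃g T) (a b : V), T.dist (h a) (h b) ≤ T.dist a b := by
    intro h a b
    by_cases hr : T.Reachable a b
    · obtain ⟨w, hw⟩ := hr.exists_walk_length_eq_dist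
      rw [← hw, ← SimpleGraph.Walk.length_map h.toHom]
      exact SimpleGraph.dist_le _
    · have hr' : ¬ T.Reachable (h a) (h b) := fun hh => hr (h.reachable_iff.1 hh)
      rw [SimpleGraph.dist_eq_zero_of_not_reachable hr']
      exact Nat.zero_le _
  refine le_antisymm (key g x y) ?_
  have := key g.symm (g x) (g y)
  simpa using this

/-- Graph automorphisms act on rays. -/
def Ray.map (g : T ≃g T) (r : Ray T) : Ray T where
  toFun n := g (r.toFun n)
  geodesic m n := by rw [dist_iso]; exact r.geodesic m n

theorem Ray.map_equiv (g : T ≃g T) {r s : Ray T} (h : r ≈ s) : r.map g ≈ s.map g := by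
  change (symmDiff (Set.range fun n => g (r.toFun n)) (Set.range fun n => g (s.toFun n))).Finite
  have e : ∀ t : Ray T, (Set.range fun n => g (t.toFun n)) = g '' Set.range t.toFun :=
    fun t => Set.range_comp g t.toFun
  rw [e, e, ← Set.image_symmDiff g.injective]
  exact Set.Finite.image g h

/-- Graph automorphisms act on ends. -/
instance : MulAction (T ≃g T) (TreeEnd T) where
  smul g := Quotient.map (Ray.map g) (fun _ _ h => Ray.map_equiv g h)
  one_smul ξ := by
    induction ξ using Quotient.inductionOn
    rfl
  mul_smul g h ξ := by
    induction ξ using Quotient.inductionOn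
    rfl

/-- The ancestor relation with respect to `ω`: the vertex `x` lies on the ray which starts at `y`
and represents `ω`. -/
def Ancestor (ω : TreeEnd T) (x y : V) : Prop :=
  ∃ r : Ray T, Quotient.mk (rayEquiv T) r = ω ∧ r.toFun 0 = y ∧ x ∈ Set.range r.toFun

/-- `z` is the maximal common ancestor of `x` and `y`. -/
def IsConfluent (ω : TreeEnd T) (x y z : V) : Prop :=
  Ancestor ω z x ∧ Ancestor ω z y ∧ ∀ w, Ancestor ω w x → Ancestor ω w y → Ancestor ω w z

/-- The maximal common ancestor of `x` and `y` (it exists and is unique in a tree). -/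
noncomputable def confluent (ω : TreeEnd T) (x y : V) : V :=
  @Classical.epsilon V ⟨x⟩ (IsConfluent ω x y)

/-- The number of steps from `x` up to the maximal common ancestor of `x` and `y`. -/
noncomputable def up (ω : TreeEnd T) (x y : V) : ℕ := T.dist x (confluent ω x y)

/-- The horocycle index (Busemann function) with respect to the end `ω` and the origin `o`. -/
noncomputable def hor (ω : TreeEnd T) (o x : V) : ℤ := (up ω x o : ℤ) - (up ω o x : ℤ)

/-- The affine group of a tree with a distinguished end `ω`: the stabilizer of `ω` in the
automorphism group. -/
def Aff (ω : TreeEnd T) : Subgroup (T ≃g T) := MulAction.stabilizer (T ≃g T) ω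

/-- `g` is a Busemann isometry which shifts the Busemann function by the constant `c`. -/
def Shifts (ω : TreeEnd T) (o : V) (g : T ≃g T) (c : ℤ) : Prop :=
  ∀ x : V, hor ω o (g x) - hor ω o x = c

end Ends

section Permutations

variable {d : ℕ} (q : Fin d → ℕ)

/-- The permutations `σ` of the coordinates such that `q (σ j) = q j` for all `j`. -/
def permGroup : Subgroup (Equiv.Perm (Fin d)) where
  carrier := {σ | ∀ j, q (σ j) = q j}
  one_mem' := fun _ => rfl
  mul_mem' := fun {σ τ} hσ hτ j => (hσ (τ j)).trans (hτ j)
  inv_mem' := fun {σ} hσ j => by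
    have h := hσ (σ⁻¹ j)
    have e : σ (σ⁻¹ j) = j := σ.apply_symm_apply j
    rw [e] at h
    exact h.symm

variable {q}

theorem permGroup_inv (σ : permGroup q) (j : Fin d) :
    q ((σ : Equiv.Perm (Fin d))⁻¹ j) = q j := (permGroup q).inv_mem σ.2 j

/-- Permutation of the coordinates of a tuple: `(σ x)_j = x_{σ⁻¹ j}`. The `j`-th coordinate lies in
an object `F (q j)` which depends only on the number `q j`, so that `σ` permutes coordinates that
lie in the same object. -/
def permute {F : ℕ → Type*} (σ : permGroup q) (x : ∀ j, F (q j)) : ∀ j, F (q j) :=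
  fun j => cast (congrArg F (permGroup_inv σ j)) (x ((σ : Equiv.Perm (Fin d))⁻¹ j))

theorem cast_index {F : ℕ → Type*} (x : ∀ j, F (q j)) {i j : Fin d} (h : i = j)
    (h' : F (q i) = F (q j)) : cast h' (x i) = x j := by
  subst h; rfl

theorem permute_one {F : ℕ → Type*} (x : ∀ j, F (q j)) : permute (1 : permGroup q) x = x := rfl

theorem permute_mul {F : ℕ → Type*} (σ τ : permGroup q) (x : ∀ j, F (q j)) :
    permute (σ * τ) x = permute σ (permute τ x) := by
  funext j
  unfold permute
  rw [cast_cast]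
  have h : ((σ * τ : permGroup q) : Equiv.Perm (Fin d))⁻¹ j
      = (τ : Equiv.Perm (Fin d))⁻¹ ((σ : Equiv.Perm (Fin d))⁻¹ j) := by
    rw [Subgroup.coe_mul, mul_inv_rev, Equiv.Perm.mul_apply]
  have e := cast_index x h (congrArg (fun i => F (q i)) h)
  rw [← e, cast_cast]

theorem cast_map {F : ℕ → Type*} {α : Type*} (φ : ∀ n, F n → α) {m n : ℕ} (h : m = n) (a : F m) :
    φ n (cast (congrArg F h) a) = φ m a := by
  subst h; rfl

theorem cast_mul {H : ℕ → Type*} [∀ n, Group (H n)] {m n : ℕ} (h : m = n) (a b : H m) :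
    cast (congrArg H h) (a * b) = cast (congrArg H h) a * cast (congrArg H h) b := by
  subst h; rfl

end Permutations

section HorocyclicProduct

variable {d : ℕ} (q : Fin d → ℕ) {V : ℕ → Type u} {T : ∀ n, SimpleGraph (V n)}
  (ω : ∀ n, TreeEnd (T n)) (o : ∀ n, V n)

/-- The vertices of `DL(q_1, …, q_d)`: tuples `x_1 ⋯ x_d` with `x_j` in the tree with index `q_j`,
whose horocycle indices add up to `0`. -/
def DLVertex : Type u :=
  {x : ∀ j, V (q j) // ∑ j, hor (ω (q j)) (o (q j)) (x j) = 0}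

/-- The Diestel-Leader graph `DL(q_1, …, q_d)`, the horocyclic product of the trees `T (q j)`. -/
def DL : SimpleGraph (DLVertex q ω o) where
  Adj x y := ∃ i j : Fin d, i ≠ j ∧ (T (q i)).Adj (x.1 i) (y.1 i) ∧
    (T (q j)).Adj (x.1 j) (y.1 j) ∧ ∀ k, k ≠ i → k ≠ j → x.1 k = y.1 k
  symm := ⟨fun _ _ ⟨i, j, hij, hi, hj, hk⟩ =>
    ⟨i, j, hij, hi.symm, hj.symm, fun k h h' => (hk k h h').symm⟩⟩
  loopless := ⟨fun _ ⟨_, _, _, hi, _, _⟩ => hi.ne rfl⟩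

/-- The horocyclic product of the affine groups of the trees `T (q j)`: tuples `g_1 ⋯ g_d` with
`g_j` in the affine group, whose shifts of the Busemann functions add up to `0`. -/
def affProduct : Subgroup (∀ j, Aff (ω (q j))) where
  carrier := {g | ∃ c : Fin d → ℤ,
    (∀ j, Shifts (ω (q j)) (o (q j)) (g j : T (q j) ≃g T (q j)) (c j)) ∧ ∑ j, c j = 0}
  one_mem' := ⟨0, fun j x => sub_self _, by simp⟩
  mul_mem' := by
    rintro g h ⟨c, hc, hc0⟩ ⟨e, he, he0⟩
    refine ⟨c + e, fun j x => ?_, ?_⟩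
    · have h1 := hc j ((h j : T (q j) ≃g T (q j)) x)
      have h2 := he j x
      change hor _ _ ((g j : T (q j) ≃g T (q j)) ((h j : T (q j) ≃g T (q j)) x)) - _ = c j + e j
      rw [← h1, ← h2]; ring
    · simp [Finset.sum_add_distrib, hc0, he0]
  inv_mem' := by
    rintro g ⟨c, hc, hc0⟩
    refine ⟨-c, fun j x => ?_, by simp [hc0]⟩
    have h1 := hc j ((g j : T (q j) ≃g T (q j))⁻¹ x)
    rw [RelIso.apply_inv_self] at h1
    change hor _ _ ((g j : T (q j) ≃g T (q j))⁻¹ x) - _ = - c j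
    rw [← h1]; ring

variable {q ω o}

theorem permute_mem_affProduct (σ : permGroup q) {g : ∀ j, Aff (ω (q j))}
    (hg : g ∈ affProduct q ω o) :
    permute (F := fun n => Aff (ω n)) σ g ∈ affProduct q ω o := by
  obtain ⟨c, hc, hc0⟩ := hg
  refine ⟨fun j => c ((σ : Equiv.Perm (Fin d))⁻¹ j), fun j => ?_, ?_⟩
  · have e := cast_map (F := fun n => Aff (ω n)) (α := ℤ → Prop)
      (fun n a => Shifts (ω n) (o n) (a : T n ≃g T n)) (permGroup_inv σ j)
      (g ((σ : Equiv.Perm (Fin d))⁻¹ j))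
    have := congrFun e (c ((σ : Equiv.Perm (Fin d))⁻¹ j))
    exact this.mpr (hc _)
  · rw [Equiv.sum_comp (σ : Equiv.Perm (Fin d))⁻¹ c]
    exact hc0

variable (q ω o)

/-- The action `(σ, g) ↦ g^σ`, `(g^σ)_j = g_{σ⁻¹ j}`, of the group of admissible permutations on
the horocyclic product of the affine groups by group automorphisms. -/
def permAction : permGroup q →* MulAut (affProduct q ω o) where
  toFun σ :=
    { toFun := fun g => ⟨permute (F := fun n => Aff (ω n)) σ g.1, permute_mem_affProduct σ g.2⟩
      invFun := fun g =>
        ⟨permute (F := fun n => Aff (ω n)) σ⁻¹ g.1, permute_mem_affProduct σ⁻¹ g.2⟩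
      left_inv := fun g => Subtype.ext <| by
        change permute (F := fun n => Aff (ω n)) σ⁻¹
          (permute (F := fun n => Aff (ω n)) σ g.1) = g.1
        rw [← permute_mul, inv_mul_cancel, permute_one]
      right_inv := fun g => Subtype.ext <| by
        change permute (F := fun n => Aff (ω n)) σ
          (permute (F := fun n => Aff (ω n)) σ⁻¹ g.1) = g.1
        rw [← permute_mul, mul_inv_cancel, permute_one]
      map_mul' := fun g h => Subtype.ext <| funext fun j =>
        cast_mul (H := fun n => Aff (ω n)) (permGroup_inv σ j) _ _ }
  map_one' := rfl
  map_mul' σ τ := MulEquiv.ext fun g => Subtype.ext <|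
    permute_mul (F := fun n => Aff (ω n)) σ τ g.1

end HorocyclicProduct

end DiestelLeader

/-! An end turns a tree into a genealogy: every vertex has one parent and `q` children, and the
Busemann function drops by one from child to parent. The trees enter only through this structure
(`IsHoroTree`), and an edge of the product goes to the parent in one coordinate and to a child in
another (`Up`).

The isometry group is found by recognising the coordinates inside the graph. The pairs which are
siblings in one coordinate and equal elsewhere are those singled out by `SibCriterion`, which speaks
of adjacency only. So an automorphism preserves them, permutes at each vertex the coordinates in
which they lie, and this permutation `τ` is constant along edges (`exists_twist`). Coordinate `τ i`
of the image then depends on coordinate `i` alone (`Twist.coord_eq`), the coordinate maps commute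
with the parent maps, and counting children gives `q (τ i) = q i`. Undoing `τ` leaves a tuple of
affine maps (`semidirectHom_bijective`).

Vertex stabilizers are compact and open and the action is transitive, so an invariant mean on the
vertices yields amenability. It is an iterated ultralimit: first over blocks of vertices with
prescribed heights, which every automorphism eventually maps onto such blocks, then over boxes that
parametrize the height vectors, on which automorphisms act by permutations and translations.

For unimodularity, let `S x` be the stabilizer of `x` among the automorphisms with `τ = 1`. Across
an edge from `x` to `y`, up in `i` and down in `j`, counting cosets gives `k i * μ (S x) = k j * μ
(S y)`, while right invariance of `μ` means that `μ (S x)` does not depend on `x`. -/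

namespace DiestelLeader

/-! ### Trees with an end, as a parent map and a height -/

/-- A homogeneous tree with a distinguished end, given by the parent function `p` and the height
`h`: every vertex has `k` children and any two vertices have a common ancestor. -/
structure IsHoroTree {W : Type*} (p : W → W) (h : W → ℤ) (k : ℕ) : Prop where
  nonempty : Nonempty W
  height_parent : ∀ x, h (p x) = h x - 1
  exists_common : ∀ x y, ∃ m n : ℕ, p^[m] x = p^[n] y
  ncard_children : ∀ x, {y | p y = x}.ncard = k

namespace IsHoroTree

variable {W : Type*} {p : W → W} {h : W → ℤ} {k : ℕ} (H : IsHoroTree p h k)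
include H

theorem height_iterate (n : ℕ) (x : W) : h (p^[n] x) = h x - n := by
  induction n generalizing x with
  | zero => simp
  | succ n ih => rw [Function.iterate_succ_apply, ih, H.height_parent]; push_cast; ring

theorem parent_ne (x : W) : p x ≠ x := fun e => by
  have := H.height_parent x
  rw [e] at this; omega

theorem exists_child (hk : 1 ≤ k) (x : W) : ∃ y, p y = x := by
  have : {y | p y = x}.Nonempty :=
    Set.nonempty_of_ncard_ne_zero (by rw [H.ncard_children]; omega)
  exact this

theorem exists_child_ne (hk : 2 ≤ k) (x y : W) : ∃ z, p z = x ∧ z ≠ y := by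
  obtain ⟨z, hz, hzy⟩ := Set.exists_ne_of_one_lt_ncard
    (s := {z | p z = x}) (by rw [H.ncard_children]; omega) y
  exact ⟨z, hz, hzy⟩

theorem finite_children (hk : 1 ≤ k) (x : W) : {y | p y = x}.Finite :=
  Set.finite_of_ncard_ne_zero (by rw [H.ncard_children]; omega)

theorem exists_height (hk : 1 ≤ k) (n : ℤ) : ∃ w, h w = n := by
  obtain ⟨w⟩ := H.nonempty
  have up : ∀ m : ℕ, ∃ v, h v = h w + m := by
    intro m
    induction m with
    | zero => exact ⟨w, by simp⟩
    | succ m ih =>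
      obtain ⟨v, hv⟩ := ih
      obtain ⟨u, hu⟩ := H.exists_child hk v
      refine ⟨u, ?_⟩
      have := H.height_parent u
      rw [hu] at this
      push_cast; omega
  rcases le_total n (h w) with hn | hn
  · refine ⟨p^[(h w - n).toNat] w, ?_⟩
    rw [H.height_iterate]; omega
  · obtain ⟨v, hv⟩ := up (n - h w).toNat
    exact ⟨v, by omega⟩

end IsHoroTree

/-! ### Vertices and edges of the horocyclic product -/

section Product

variable {d : ℕ} {W : Fin d → Type*}

/-- The vertices of the horocyclic product. -/
abbrev HProd (h : ∀ j, W j → ℤ) : Type _ := {x : ∀ j, W j // ∑ j, h j (x j) = 0}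

/-- `y` arises from `x` by going up in the `i`-th and down in the `j`-th coordinate. -/
def Up (p : ∀ j, W j → W j) {h : ∀ j, W j → ℤ} (i j : Fin d) (x y : HProd h) : Prop :=
  i ≠ j ∧ y.1 i = p i (x.1 i) ∧ p j (y.1 j) = x.1 j ∧ ∀ k, k ≠ i → k ≠ j → y.1 k = x.1 k

/-- `x` and `y` differ only in the `j`-th coordinate, where they are siblings. -/
def Sib (p : ∀ j, W j → W j) {h : ∀ j, W j → ℤ} (j : Fin d) (x y : HProd h) : Prop :=
  x.1 j ≠ y.1 j ∧ p j (x.1 j) = p j (y.1 j) ∧ ∀ k, k ≠ j → y.1 k = x.1 k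

variable {p : ∀ j, W j → W j} {h : ∀ j, W j → ℤ} {k : Fin d → ℕ}

theorem Up.symm {i j : Fin d} {x y : HProd h} (u : Up p i j x y) : Up p j i y x :=
  ⟨u.1.symm, u.2.2.1.symm, u.2.1.symm, fun l h1 h2 => (u.2.2.2 l h2 h1).symm⟩

theorem Sib.ne {j : Fin d} {x y : HProd h} (u : Sib p j x y) : x ≠ y := fun e => u.1 (by rw [e])

section

variable (H : ∀ j, IsHoroTree (p j) (h j) (k j))
include H

theorem exists_up {i j : Fin d} (hij : i ≠ j) (x : HProd h) {c : W j} (hc : p j c = x.1 j) :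
    ∃ y : HProd h, Up p i j x y ∧ y.1 j = c := by
  classical
  let y : ∀ l, W l := Function.update (Function.update x.1 i (p i (x.1 i))) j c
  have yi : y i = p i (x.1 i) := by simp [y, hij]
  have yj : y j = c := by simp [y]
  have yk : ∀ l, l ≠ i → l ≠ j → y l = x.1 l := fun l h1 h2 => by simp [y, h1, h2]
  have hsum : ∑ l, (h l (y l) - h l (x.1 l)) = 0 := by
    rw [Finset.sum_eq_add i j hij, yi, yj, (H i).height_parent, ← hc, (H j).height_parent]
    · ring
    · intro l _ hl
      rw [yk l hl.1 hl.2, sub_self]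
    · simp
    · simp
  rw [Finset.sum_sub_distrib, x.2, sub_zero] at hsum
  exact ⟨⟨y, hsum⟩, ⟨hij, yi, (congrArg (p j) yj).trans hc, yk⟩, yj⟩

theorem exists_sib (hk : ∀ j, 2 ≤ k j) (j : Fin d) (x : HProd h) : ∃ y : HProd h, Sib p j x y := by
  classical
  obtain ⟨c, hc, hne⟩ := (H j).exists_child_ne (hk j) (p j (x.1 j)) (x.1 j)
  let y : ∀ l, W l := Function.update x.1 j c
  have yj : y j = c := by simp [y]
  have yk : ∀ l, l ≠ j → y l = x.1 l := fun l h2 => by simp [y, h2]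
  have hsum : ∑ l, (h l (y l) - h l (x.1 l)) = 0 := by
    refine Finset.sum_eq_zero fun l _ => ?_
    by_cases hl : l = j
    · subst hl
      have h1 := (H l).height_parent c
      have h2 := (H l).height_parent (x.1 l)
      rw [yj]
      rw [hc] at h1; omega
    · rw [yk l hl, sub_self]
  rw [Finset.sum_sub_distrib, x.2, sub_zero] at hsum
  exact ⟨⟨y, hsum⟩, fun e => hne (yj.symm.trans e.symm),
    hc.symm.trans (congrArg (p j) yj).symm, yk⟩

theorem exists_completion (hk : ∀ j, 2 ≤ k j) (i : Fin d) (w : ∀ l, W l) :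
    ∃ x : HProd h, ∀ l, l ≠ i → x.1 l = w l := by
  classical
  obtain ⟨v, hv⟩ := (H i).exists_height (by have := hk i; omega) (h i (w i) - ∑ l, h l (w l))
  let y : ∀ l, W l := Function.update w i v
  have yi : y i = v := by simp [y]
  have yk : ∀ l, l ≠ i → y l = w l := fun l h2 => by simp [y, h2]
  have hsum : ∑ l, (h l (y l) - h l (w l)) = - ∑ l, h l (w l) := by
    rw [Finset.sum_eq_single i, yi, hv]
    · ring
    · intro l _ hl
      rw [yk l hl, sub_self]
    · simp
  rw [Finset.sum_sub_distrib] at hsum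
  exact ⟨⟨y, by linarith⟩, yk⟩

theorem exists_coord (hd : 2 ≤ d) (hk : ∀ j, 2 ≤ k j) (j : Fin d) (v : W j) :
    ∃ x : HProd h, x.1 j = v := by
  classical
  have : Nontrivial (Fin d) := Fin.nontrivial_iff_two_le.2 hd
  obtain ⟨i, hi⟩ := exists_ne j
  have w0 : ∀ l, W l := fun l => (H l).nonempty.some
  obtain ⟨x, hx⟩ := exists_completion H hk i (Function.update w0 j v)
  exact ⟨x, by rw [hx j hi.symm]; simp⟩

/-- Induction for vertices which agree in the `i`-th coordinate. -/
theorem coord_induction (hk : ∀ j, 2 ≤ k j) (i : Fin d) (R : HProd h → HProd h → Prop)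
    (refl : ∀ x, R x x)
    (step : ∀ a b x x' y y', a ≠ i → b ≠ i → Up p a i x x' → Up p b i y y' →
      x'.1 i = y'.1 i → R x' y' → R x y) :
    ∀ x y, x.1 i = y.1 i → R x y := by
  classical
  -- `m l` and `n l` count the steps up to a common ancestor in coordinate `l`. Each induction step
  -- spends one of them on either side and pays by descending to the same child in coordinate `i`.
  -- Both height sums vanish, so the totals of `m` and `n` agree and the two sides run out together.
  have key : ∀ (M : ℕ) (m n : Fin d → ℕ) (x y : HProd h), m i = 0 → n i = 0 → ∑ l, m l = M →
      x.1 i = y.1 i → (∀ l, (p l)^[m l] (x.1 l) = (p l)^[n l] (y.1 l)) → R x y := by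
    intro M
    induction M with
    | zero =>
      intro m n x y hm hn hM hi hmn
      have hsum : ∑ l, (h l (x.1 l) - m l) = ∑ l, (h l (y.1 l) - n l) := by
        refine Finset.sum_congr rfl fun l _ => ?_
        rw [← (H l).height_iterate, ← (H l).height_iterate, hmn]
      rw [Finset.sum_sub_distrib, Finset.sum_sub_distrib, x.2, y.2, ← Nat.cast_sum,
        ← Nat.cast_sum] at hsum
      have hN : ∑ l, n l = 0 := by omega
      rw [Finset.sum_eq_zero_iff] at hM hN
      have : x = y := Subtype.ext <| funext fun l => by
        have := hmn l
        rwa [hM l (Finset.mem_univ _), hN l (Finset.mem_univ _)] at this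
      rw [this]; exact refl y
    | succ M ih =>
      intro m n x y hm hn hM hi hmn
      have hsum : ∑ l, (h l (x.1 l) - m l) = ∑ l, (h l (y.1 l) - n l) := by
        refine Finset.sum_congr rfl fun l _ => ?_
        rw [← (H l).height_iterate, ← (H l).height_iterate, hmn]
      rw [Finset.sum_sub_distrib, Finset.sum_sub_distrib, x.2, y.2, ← Nat.cast_sum,
        ← Nat.cast_sum] at hsum
      have hN : ∑ l, n l = M + 1 := by omega
      obtain ⟨a, -, ha⟩ := Finset.exists_ne_zero_of_sum_ne_zero (by rw [hM]; omega : ∑ l, m l ≠ 0)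
      obtain ⟨b, -, hb⟩ := Finset.exists_ne_zero_of_sum_ne_zero (by rw [hN]; omega : ∑ l, n l ≠ 0)
      have hai : a ≠ i := by rintro rfl; exact ha hm
      have hbi : b ≠ i := by rintro rfl; exact hb hn
      obtain ⟨c, hc⟩ := (H i).exists_child (by have := hk i; omega) (x.1 i)
      obtain ⟨x', hx', hxc⟩ := exists_up H hai x hc
      obtain ⟨y', hy', hyc⟩ := exists_up H hbi y (hc.trans hi)
      refine step a b x x' y y' hai hbi hx' hy' (hxc.trans hyc.symm) ?_
      have red : ∀ (m : Fin d → ℕ) (a : Fin d) (x x' : HProd h), m a ≠ 0 → Up p a i x x' →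
          ∀ l, l ≠ i → (p l)^[Function.update m a (m a - 1) l] (x'.1 l) = (p l)^[m l] (x.1 l) := by
        intro m a x x' hma hx l hl
        by_cases hla : l = a
        · subst hla
          rw [Function.update_self, hx.2.1, ← Function.iterate_succ_apply]
          congr 2; omega
        · rw [Function.update_of_ne hla, hx.2.2.2 l hla hl]
      refine ih (Function.update m a (m a - 1)) (Function.update n b (n b - 1)) x' y' ?_ ?_ ?_
        (hxc.trans hyc.symm) ?_
      · rw [Function.update_of_ne hai.symm, hm]
      · rw [Function.update_of_ne hbi.symm, hn]
      · have e1 := Finset.add_sum_erase Finset.univ m (Finset.mem_univ a)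
        rw [Finset.sum_update_of_mem (Finset.mem_univ a), ← Finset.erase_eq]
        omega
      · intro l
        by_cases hl : l = i
        · subst hl
          rw [Function.update_of_ne hai.symm, Function.update_of_ne hbi.symm, hm, hn, hxc, hyc]
        · rw [red m a x x' ha hx' l hl, red n b y y' hb hy' l hl, hmn l]
  intro x y hi
  choose m n hmn using fun l => (H l).exists_common (x.1 l) (y.1 l)
  refine key _ (Function.update m i 0) (Function.update n i 0) x y (by simp) (by simp) rfl hi ?_
  intro l
  by_cases hl : l = i
  · subst hl; simpa using hi
  · rw [Function.update_of_ne hl, Function.update_of_ne hl, hmn]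

end

/-! ### Connectedness, and siblings as seen by the graph -/

section Graph

variable {G : SimpleGraph (HProd h)} (hG : ∀ x y, G.Adj x y ↔ ∃ i j, Up p i j x y)
  (H : ∀ j, IsHoroTree (p j) (h j) (k j))

-- Vertices which agree in coordinate `i` are joined by `coord_induction`; climbing in `i` at the
-- expense of another coordinate `j` brings any two vertices to this case.
include hG H in
theorem hprod_preconnected (hd : 2 ≤ d) (hk : ∀ j, 2 ≤ k j) : G.Preconnected := by
  have : Nontrivial (Fin d) := Fin.nontrivial_iff_two_le.2 hd
  obtain ⟨i, j, hij⟩ := exists_pair_ne (Fin d)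
  have adj : ∀ {a b x y}, Up p a b x y → G.Adj x y := fun u => (hG _ _).2 ⟨_, _, u⟩
  have key := coord_induction H hk i (fun x y => G.Reachable x y) (fun x => .refl x)
    (fun a b x x' y y' _ _ hx hy _ r =>
      ((adj hx).reachable.trans r).trans (adj hy).symm.reachable)
  have lift : ∀ (n : ℕ) (x : HProd h), ∃ x', G.Reachable x x' ∧ x'.1 i = (p i)^[n] (x.1 i) := by
    intro n
    induction n with
    | zero => exact fun x => ⟨x, .refl x, rfl⟩
    | succ n ih =>
      intro x
      obtain ⟨c, hc⟩ := (H j).exists_child (by have := hk j; omega) (x.1 j)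
      obtain ⟨y, hy, -⟩ := exists_up H hij x hc
      obtain ⟨x', h1, h2⟩ := ih y
      exact ⟨x', (adj hy).reachable.trans h1, by rw [h2, hy.2.1, Function.iterate_succ_apply]⟩
  intro x y
  obtain ⟨m, n, hmn⟩ := (H i).exists_common (x.1 i) (y.1 i)
  obtain ⟨x', h1, h2⟩ := lift m x
  obtain ⟨y', h3, h4⟩ := lift n y
  exact (h1.trans (key x' y' (by rw [h2, h4, hmn]))).trans h3.symm

/-- A graph theoretic property which characterizes pairs of vertices that differ in one coordinate
only, where they are siblings. -/
def SibCriterion (G : SimpleGraph (HProd h)) (x y : HProd h) : Prop :=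
  x ≠ y ∧ ¬ G.Adj x y ∧
    (∃ u w, (G.Adj u x ∧ G.Adj u y) ∧ (G.Adj w x ∧ G.Adj w y) ∧ u ≠ w ∧ ¬ G.Adj u w) ∧
    (4 ≤ d → ∃ a b c, (G.Adj a x ∧ G.Adj a y) ∧ (G.Adj b x ∧ G.Adj b y) ∧
      (G.Adj c x ∧ G.Adj c y) ∧ G.Adj a b ∧ G.Adj b c ∧ G.Adj a c)

include H in
theorem Sib.not_up {j : Fin d} {x y : HProd h} (u : Sib p j x y) (a b : Fin d) :
    ¬ Up p a b x y := by
  rintro ⟨hab, h1, h2, -⟩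
  have ha : a = j := by
    by_contra hne
    rw [u.2.2 a hne] at h1
    exact (H a).parent_ne _ h1.symm
  have hb : b = j := by
    by_contra hne
    rw [u.2.2 b hne] at h2
    exact (H b).parent_ne _ h2
  exact hab (ha.trans hb.symm)

/-- Two edges out of `x` which go down in the same coordinate or up in the same coordinate. -/
theorem Up.up_of_fst_eq {i j l : Fin d} {u x y : HProd h} (h1 : Up p i j u x) (h2 : Up p i l u y)
    (hjl : j ≠ l) : Up p j l x y := by
  obtain ⟨a1, a2, a3, a4⟩ := h1
  obtain ⟨b1, b2, b3, b4⟩ := h2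
  refine ⟨hjl, ?_, ?_, fun m hm hm' => ?_⟩
  · rw [a3, b4 j a1.symm hjl]
  · rw [b3, a4 l b1.symm hjl.symm]
  · by_cases hmi : m = i
    · subst hmi; rw [a2, b2]
    · rw [a4 m hmi hm, b4 m hmi hm']

-- Climbing in coordinate `j` merges siblings, so every edge up in `j` and down elsewhere leads to a
-- common neighbour. Two children in the same descending coordinate give nonadjacent ones; three
-- different descending coordinates, available from `d = 4` on, give a triangle.
include hG H in
theorem Sib.criterion (hd : 2 ≤ d) (hk : ∀ j, 2 ≤ k j) {j : Fin d} {x y : HProd h}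
    (s : Sib p j x y) : SibCriterion G x y := by
  classical
  have : Nontrivial (Fin d) := Fin.nontrivial_iff_two_le.2 hd
  have adj : ∀ {a b x y}, Up p a b x y → G.Adj x y := fun u => (hG _ _).2 ⟨_, _, u⟩
  have trans : ∀ {l z}, Up p j l x z → Up p j l y z := by
    rintro l z ⟨h1, h2, h3, h4⟩
    refine ⟨h1, by rw [h2, s.2.1], by rw [h3, s.2.2 l h1.symm], fun m hm hm' => ?_⟩
    rw [h4 m hm hm', s.2.2 m hm]
  refine ⟨s.ne, fun ha => ?_, ?_, fun h4 => ?_⟩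
  · obtain ⟨a, b, u⟩ := (hG _ _).1 ha
    exact s.not_up H a b u
  · obtain ⟨l, hl⟩ := exists_ne j
    obtain ⟨c, hc⟩ := (H l).exists_child (by have := hk l; omega) (x.1 l)
    obtain ⟨c', hc', hne⟩ := (H l).exists_child_ne (hk l) (x.1 l) c
    obtain ⟨u, hu, huc⟩ := exists_up H hl.symm x hc
    obtain ⟨w, hw, hwc⟩ := exists_up H hl.symm x hc'
    have hs : Sib p l u w := by
      refine ⟨by rw [huc, hwc]; exact hne.symm, by rw [huc, hwc, hc, hc'], fun m hm => ?_⟩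
      by_cases hmj : m = j
      · subst hmj; rw [hu.2.1, hw.2.1]
      · rw [hu.2.2.2 m hmj hm, hw.2.2.2 m hmj hm]
    refine ⟨u, w, ⟨(adj hu).symm, (adj (trans hu)).symm⟩, ⟨(adj hw).symm, (adj (trans hw)).symm⟩,
      hs.ne, fun ha => ?_⟩
    obtain ⟨a, b, u⟩ := (hG _ _).1 ha
    exact hs.not_up H a b u
  · have hc : 2 < ({j}ᶜ : Finset (Fin d)).card := by
      rw [Finset.card_compl, Fintype.card_fin, Finset.card_singleton]; omega
    obtain ⟨a, b, c, ha, hb, hc, hab, hac, hbc⟩ := Finset.two_lt_card_iff.1 hc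
    simp only [Finset.mem_compl, Finset.mem_singleton] at ha hb hc
    have ex : ∀ l, l ≠ j → ∃ z, Up p j l x z := fun l hl => by
      obtain ⟨c, hc⟩ := (H l).exists_child (by have := hk l; omega) (x.1 l)
      obtain ⟨u, hu, -⟩ := exists_up H hl.symm x hc
      exact ⟨u, hu⟩
    obtain ⟨za, h1⟩ := ex a ha
    obtain ⟨zb, h2⟩ := ex b hb
    obtain ⟨zc, h3⟩ := ex c hc
    exact ⟨za, zb, zc, ⟨(adj h1).symm, (adj (trans h1)).symm⟩,
      ⟨(adj h2).symm, (adj (trans h2)).symm⟩, ⟨(adj h3).symm, (adj (trans h3)).symm⟩,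
      adj (h1.up_of_fst_eq h2 hab), adj (h2.up_of_fst_eq h3 hbc), adj (h1.up_of_fst_eq h3 hac)⟩

end Graph

end Product

/-! ### Common neighbours, by the types of the edges -/

section Product

variable {d : ℕ} {W : Fin d → Type*} {p : ∀ j, W j → W j} {h : ∀ j, W j → ℤ} {k : Fin d → ℕ}

section CommonNeighbours

variable (hp : ∀ m v, h m (p m v) = h m v - 1)
  {i j a b c e l l' : Fin d} {u x y z : HProd h}
include hp

/-- The common neighbours of two vertices which arise from `u` by going down to different children
in the same coordinate and going up in different coordinates. -/
theorem common_of_down (hil : i ≠ l) (hx : Up p i j u x) (hy : Up p l j u y)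
    (hne : x.1 j ≠ y.1 j) (za : Up p a b z x) (zc : Up p c e z y) : z = u := by
  obtain ⟨x1, x2, x3, x4⟩ := hx
  obtain ⟨y1, y2, y3, y4⟩ := hy
  obtain ⟨a1, a2, a3, a4⟩ := za
  obtain ⟨c1, c2, c3, c4⟩ := zc
  have hb : b = j := by grind
  have he : e = j := by grind
  subst hb he
  have ha : a = i := by grind
  have hc : c = l := by grind
  subst ha hc
  refine Subtype.ext <| funext fun m => ?_
  grind

/-- In coordinate `j` the vertices `x` and `y` are two generations apart, so a common neighbour must
agree with `u` there. All common neighbours but `u` turn out to be adjacent to `u`, which rules out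
the nonadjacent pair in `SibCriterion`. -/
theorem common_of_path (hx : Up p i j u x) (hy : Up p j l u y)
    (za : Up p a b z x) (zc : Up p c e z y) : z = u ∨ Up p i l u z := by
  obtain ⟨x1, x2, x3, x4⟩ := hx
  obtain ⟨y1, y2, y3, y4⟩ := hy
  obtain ⟨a1, a2, a3, a4⟩ := za
  obtain ⟨c1, c2, c3, c4⟩ := zc
  have hb : b = j := by grind
  have hc : c = j := by grind
  subst hb hc
  by_cases ha : a = i
  · left
    subst ha
    have he : e = l := by grind
    subst he
    refine Subtype.ext <| funext fun m => ?_
    grind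
  · right
    refine ⟨?_, ?_, ?_, ?_⟩
    · grind
    · grind
    · grind
    · grind

/-- Four coordinates of `x` and `y` differ and each edge changes only two. So the two coordinates in
which `z` differs from `x` already agree with `y`, with two choices for each: the common neighbours
are cells of a two by two grid. -/
theorem common_of_disjoint (hil : i ≠ l) (hil' : i ≠ l') (hjl : j ≠ l) (hjl' : j ≠ l')
    (hx : Up p i j u x) (hy : Up p l l' u y)
    (za : Up p a b z x) (zc : Up p c e z y) :
    (a = i ∨ a = l') ∧ (b = j ∨ b = l) ∧ z.1 a = y.1 a ∧ z.1 b = y.1 b := by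
  obtain ⟨x1, x2, x3, x4⟩ := hx
  obtain ⟨y1, y2, y3, y4⟩ := hy
  obtain ⟨a1, a2, a3, a4⟩ := za
  obtain ⟨c1, c2, c3, c4⟩ := zc
  have di : x.1 i ≠ y.1 i := by grind
  have dj : x.1 j ≠ y.1 j := by grind
  have dl : x.1 l ≠ y.1 l := by grind
  have dl' : x.1 l' ≠ y.1 l' := by grind
  have hi : i = a ∨ i = b ∨ i = c ∨ i = e := by grind
  have hj : j = a ∨ j = b ∨ j = c ∨ j = e := by grind
  have hl : l = a ∨ l = b ∨ l = c ∨ l = e := by grind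
  have hl' : l' = a ∨ l' = b ∨ l' = c ∨ l' = e := by grind
  have ha : a ≠ c ∧ a ≠ e := by grind
  have hb : b ≠ c ∧ b ≠ e := by grind
  have za : z.1 a = y.1 a := by grind
  have zb : z.1 b = y.1 b := by grind
  refine ⟨?_, ?_, za, zb⟩
  · grind
  · grind

end CommonNeighbours
end Product
section Product

variable {d : ℕ} {W : Fin d → Type*} {p : ∀ j, W j → W j} {h : ∀ j, W j → ℤ} {k : Fin d → ℕ}

theorem four_le_of_distinct {i j l l' : Fin d} (h1 : i ≠ j) (h2 : l ≠ l') (hil : i ≠ l)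
    (hil' : i ≠ l') (hjl : j ≠ l) (hjl' : j ≠ l') : 4 ≤ d := by
  have h : ({i, j, l, l'} : Finset (Fin d)).card = 4 := by
    rw [Finset.card_eq_succ]
    refine ⟨i, {j, l, l'}, by simp [*], rfl, ?_⟩
    rw [Finset.card_eq_three]
    exact ⟨j, l, l', hjl, hjl', h2, rfl⟩
  have := Finset.card_le_univ ({i, j, l, l'} : Finset (Fin d))
  rw [h, Fintype.card_fin] at this
  exact this

/-- Vertices which differ in three coordinates are not neighbours. -/
theorem not_up_of_three {i j l a b : Fin d} {x y : HProd h} (hij : i ≠ j) (hil : i ≠ l)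
    (hjl : j ≠ l) (xi : x.1 i ≠ y.1 i) (xj : x.1 j ≠ y.1 j) (xl : x.1 l ≠ y.1 l) :
    ¬ Up p a b x y := by
  rintro ⟨-, -, -, u⟩
  grind

theorem Up.ne (hp : ∀ m v, h m (p m v) = h m v - 1) {i j : Fin d} {x y : HProd h}
    (u : Up p i j x y) : x ≠ y := by
  rintro rfl
  have := hp i (x.1 i)
  rw [← u.2.1] at this
  omega

/-- Cells of the grid in different rows and columns differ in at least three coordinates, hence are
not adjacent. -/
theorem Up.eq_xor_eq (hp : ∀ m v, h m (p m v) = h m v - 1) {a b a' b' s t : Fin d}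
    {x y z z' : HProd h} (xa : x.1 a ≠ y.1 a)
    (xb : x.1 b ≠ y.1 b) (xa' : x.1 a' ≠ y.1 a') (hab : a ≠ b) (hab' : a ≠ b') (hab'' : a' ≠ b)
    (za : z.1 a = y.1 a) (zb : z.1 b = y.1 b) (zm : ∀ m, m ≠ a → m ≠ b → x.1 m = z.1 m)
    (za' : z'.1 a' = y.1 a') (zb' : z'.1 b' = y.1 b')
    (zm' : ∀ m, m ≠ a' → m ≠ b' → x.1 m = z'.1 m) (u : Up p s t z z') :
    (a = a' ∧ b ≠ b') ∨ (a ≠ a' ∧ b = b') := by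
  by_cases ha : a = a'
  · by_cases hb : b = b'
    · subst ha hb
      refine (u.ne hp <| Subtype.ext <| funext fun m => ?_).elim
      by_cases h1 : m = a
      · rw [h1, za, za']
      by_cases h2 : m = b
      · rw [h2, zb, zb']
      rw [← zm m h1 h2, zm' m h1 h2]
    · exact Or.inl ⟨ha, hb⟩
  · by_cases hb : b = b'
    · exact Or.inr ⟨ha, hb⟩
    · refine (not_up_of_three (i := a) (j := b) (l := a') hab ha hab''.symm ?_ ?_ ?_ u).elim
      · rw [za, ← zm' a ha hab']; exact xa.symm
      · rw [zb, ← zm' b hab''.symm hb]; exact xb.symm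
      · rw [za', ← zm a' (Ne.symm ha) hab'']; exact xa'

section

variable (hp : ∀ m v, h m (p m v) = h m v - 1)
include hp

theorem Up.unique {i j a b : Fin d} {x y : HProd h} (u : Up p i j x y) (v : Up p a b x y) :
    a = i ∧ b = j := by
  obtain ⟨u1, u2, u3, u4⟩ := u
  obtain ⟨v1, v2, v3, v4⟩ := v
  grind

theorem Sib.eq_of_up {i j l : Fin d} {x x' y : HProd h} (u : Up p i j x y) (s : Sib p l x x')
    {a b : Fin d} (v : Up p a b x' y) : l = i := by
  obtain ⟨u1, u2, u3, u4⟩ := u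
  obtain ⟨v1, v2, v3, v4⟩ := v
  obtain ⟨s1, s2, s3⟩ := s
  grind

theorem Sib.eq_of_up_up {i j l m : Fin d} {x x' y y' : HProd h} (u : Up p i j x y)
    (s : Sib p l x x') (t : Sib p m y y') (hl : l ≠ i) {a b : Fin d} (v : Up p a b x' y') :
    m = l := by
  obtain ⟨u1, u2, u3, u4⟩ := u
  obtain ⟨v1, v2, v3, v4⟩ := v
  obtain ⟨s1, s2, s3⟩ := s
  obtain ⟨t1, t2, t3⟩ := t
  have e1 := hp l (x.1 l)
  have e2 := hp l (x'.1 l)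
  have e3 := hp m (y.1 m)
  have e4 := hp m (y'.1 m)
  grind

omit hp in
theorem Sib.eq_of_sib {i j l : Fin d} {x y z : HProd h} (s : Sib p i x y) (t : Sib p j x z)
    (r : Sib p l y z) : i = j := by
  obtain ⟨s1, s2, s3⟩ := s
  obtain ⟨t1, t2, t3⟩ := t
  obtain ⟨r1, r2, r3⟩ := r
  grind

omit hp in
theorem Sib.trans {i : Fin d} {x y z : HProd h} (s : Sib p i x y) (t : Sib p i x z) (hne : y ≠ z) :
    Sib p i y z := by
  obtain ⟨s1, s2, s3⟩ := s
  obtain ⟨t1, t2, t3⟩ := t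
  refine ⟨fun e => hne <| Subtype.ext <| funext fun m => ?_, by rw [← s2, t2], fun m hm => ?_⟩
  · by_cases hm : m = i
    · subst hm; exact e
    · rw [s3 m hm, t3 m hm]
  · rw [s3 m hm, t3 m hm]

/-- The edges from a common neighbour `u` to `x` and `y` are compared by type. Equal types give
siblings; the same climbing coordinate with different descending ones, or descent to the same child
with different climbing ones, makes `x` and `y` adjacent. Different children of one vertex, with
different climbing coordinates, leave `u` as the only common neighbour; a coordinate used in
opposite directions is `common_of_path`. Four distinct coordinates remain. -/
theorem SibCriterion.sib {G : SimpleGraph (HProd h)} (hG : ∀ x y, G.Adj x y ↔ ∃ i j, Up p i j x y)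
    {x y : HProd h} (hxy : SibCriterion G x y) : ∃ j, Sib p j x y := by
  obtain ⟨hne, hadj, ⟨u, w, ⟨hux, huy⟩, ⟨hwx, hwy⟩, huw, hnuw⟩, htri⟩ := hxy
  obtain ⟨i, j, hx⟩ := (hG _ _).1 hux
  obtain ⟨l, l', hy⟩ := (hG _ _).1 huy
  obtain ⟨a, b, wx⟩ := (hG _ _).1 hwx
  obtain ⟨c, e, wy⟩ := (hG _ _).1 hwy
  have adj : ∀ {a b x y}, Up p a b x y → G.Adj x y := fun u => (hG _ _).2 ⟨_, _, u⟩
  by_cases hil : i = l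
  · subst hil
    by_cases hjl : j = l'
    · subst hjl
      obtain ⟨x1, x2, x3, x4⟩ := hx
      obtain ⟨y1, y2, y3, y4⟩ := hy
      have key : ∀ m, m ≠ j → y.1 m = x.1 m := fun m hm => by
        by_cases hmi : m = i
        · subst hmi; rw [x2, y2]
        · rw [x4 m hmi hm, y4 m hmi hm]
      refine ⟨j, fun e => hne <| Subtype.ext <| funext fun m => ?_, by rw [x3, y3], key⟩
      by_cases hm : m = j
      · subst hm; exact e
      · exact (key m hm).symm
    · exact (hadj (adj (hx.up_of_fst_eq hy hjl))).elim
  by_cases hjl' : j = l'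
  · subst hjl'
    by_cases hj : x.1 j = y.1 j
    · refine (hadj (adj (a := l) (b := i) ⟨Ne.symm hil, ?_, ?_, ?_⟩)).elim
      all_goals
        obtain ⟨x1, x2, x3, x4⟩ := hx
        obtain ⟨y1, y2, y3, y4⟩ := hy
        grind
    · exact (huw (common_of_down hp hil hx hy hj wx wy).symm).elim
  by_cases hjl : j = l
  · subst hjl
    rcases common_of_path hp hx hy wx wy with r | r
    · exact (huw r.symm).elim
    · exact (hnuw (adj r)).elim
  by_cases hil' : i = l'
  · subst hil'
    rcases common_of_path hp hy hx wy wx with r | r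
    · exact (huw r.symm).elim
    · exact (hnuw (adj r)).elim
  exfalso
  obtain ⟨z, z', z'', ⟨h1, h2⟩, ⟨h3, h4⟩, ⟨h5, h6⟩, h12, h23, h13⟩ :=
    htri (four_le_of_distinct hx.1 hy.1 hil hil' hjl hjl')
  have di : x.1 i ≠ y.1 i ∧ x.1 j ≠ y.1 j ∧ x.1 l ≠ y.1 l ∧ x.1 l' ≠ y.1 l' := by
    obtain ⟨x1, x2, x3, x4⟩ := hx
    obtain ⟨y1, y2, y3, y4⟩ := hy
    grind
  obtain ⟨di, dj, dl, dl'⟩ := di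
  have hij := hx.1
  have hll := hy.1
  have cls : ∀ z, G.Adj z x → G.Adj z y → ∃ a b : Fin d, (a = i ∨ a = l') ∧ (b = j ∨ b = l) ∧
      z.1 a = y.1 a ∧ z.1 b = y.1 b ∧ ∀ m, m ≠ a → m ≠ b → x.1 m = z.1 m := by
    intro z hzx hzy
    obtain ⟨a, b, zx⟩ := (hG _ _).1 hzx
    obtain ⟨c, e, zy⟩ := (hG _ _).1 hzy
    obtain ⟨ha, hb, hc, he⟩ := common_of_disjoint hp hil hil' hjl hjl' hx hy zx zy
    exact ⟨a, b, ha, hb, hc, he, zx.2.2.2⟩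
  have key : ∀ a b a' b', (a = i ∨ a = l') → (b = j ∨ b = l) → (a' = i ∨ a' = l') →
      (b' = j ∨ b' = l) → x.1 a ≠ y.1 a ∧ x.1 b ≠ y.1 b ∧ x.1 a' ≠ y.1 a' ∧ a ≠ b ∧ a ≠ b' ∧
        a' ≠ b := by
    rintro a b a' b' (rfl | rfl) (rfl | rfl) (rfl | rfl) (rfl | rfl) <;>
      refine ⟨?_, ?_, ?_, ?_, ?_, ?_⟩ <;> first | assumption | exact Ne.symm (by assumption)
  have xor : ∀ {a b a' b' z z'}, (a = i ∨ a = l') → (b = j ∨ b = l) → (a' = i ∨ a' = l') →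
      (b' = j ∨ b' = l) → z.1 a = y.1 a → z.1 b = y.1 b →
      (∀ m, m ≠ a → m ≠ b → x.1 m = z.1 m) → z'.1 a' = y.1 a' → z'.1 b' = y.1 b' →
      (∀ m, m ≠ a' → m ≠ b' → x.1 m = z'.1 m) → G.Adj z z' →
      (a = a' ∧ b ≠ b') ∨ (a ≠ a' ∧ b = b') := by
    intro a b a' b' z z' h1 h2 h3 h4 za zb zm za' zb' zm' hz
    obtain ⟨s, t, u⟩ := (hG _ _).1 hz
    obtain ⟨k1, k2, k3, k4, k5, k6⟩ := key a b a' b' h1 h2 h3 h4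
    exact u.eq_xor_eq hp k1 k2 k3 k4 k5 k6 za zb zm za' zb' zm'
  obtain ⟨a, b, ha, hb, za, zb, zm⟩ := cls z h1 h2
  obtain ⟨a', b', ha', hb', za', zb', zm'⟩ := cls z' h3 h4
  obtain ⟨a'', b'', ha'', hb'', za'', zb'', zm''⟩ := cls z'' h5 h6
  have e1 := xor ha hb ha' hb' za zb zm za' zb' zm' h12
  have e2 := xor ha' hb' ha'' hb'' za' zb' zm' za'' zb'' zm'' h23
  have e3 := xor ha hb ha'' hb'' za zb zm za'' zb'' zm'' h13
  -- No three cells of a two by two grid pairwise share exactly one of row and column, so the common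
  -- neighbours contain no triangle.
  clear * - ha hb ha' hb' ha'' hb'' e1 e2 e3
  grind

end
end Product
-- Automorphisms permute the types of edges
section Product

variable {d : ℕ} {W : Fin d → Type*} {p : ∀ j, W j → W j} {h : ∀ j, W j → ℤ} {k : Fin d → ℕ}
  {G : SimpleGraph (HProd h)}

theorem SibCriterion.map {x y : HProd h} (s : SibCriterion G x y) (φ : G ≃g G) :
    SibCriterion G (φ x) (φ y) := by
  obtain ⟨h1, h2, ⟨u, w, h3, h4, h5, h6⟩, h7⟩ := s
  have adj : ∀ {a b}, G.Adj a b → G.Adj (φ a) (φ b) := fun h => φ.map_adj_iff.2 h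
  refine ⟨φ.injective.ne h1, fun h => h2 (φ.map_adj_iff.1 h), ⟨φ u, φ w, ⟨adj h3.1, adj h3.2⟩,
    ⟨adj h4.1, adj h4.2⟩, φ.injective.ne h5, fun h => h6 (φ.map_adj_iff.1 h)⟩, fun hd => ?_⟩
  obtain ⟨a, b, c, ha, hb, hc, hab, hbc, hac⟩ := h7 hd
  exact ⟨φ a, φ b, φ c, ⟨adj ha.1, adj ha.2⟩, ⟨adj hb.1, adj hb.2⟩, ⟨adj hc.1, adj hc.2⟩,
    adj hab, adj hbc, adj hac⟩

/-- The automorphism `φ` permutes the types of edges according to `τ`. -/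
def Twist (p : ∀ j, W j → W j) (φ : G ≃g G) (τ : Equiv.Perm (Fin d)) : Prop :=
  ∀ i j x y, Up p i j x y → Up p (τ i) (τ j) (φ x) (φ y)

section

variable (hG : ∀ x y, G.Adj x y ↔ ∃ i j, Up p i j x y) (H : ∀ j, IsHoroTree (p j) (h j) (k j))
  (hd : 2 ≤ d) (hk : ∀ j, 2 ≤ k j)
include hG H hd hk

theorem Sib.map {j : Fin d} {x y : HProd h} (s : Sib p j x y) (φ : G ≃g G) :
    ∃ j', Sib p j' (φ x) (φ y) :=
  ((s.criterion hG H hd hk).map φ).sib (fun j => (H j).height_parent) hG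

/-- Two different siblings of `x` are siblings of each other exactly when they lie in the same
coordinate. As `φ` and its inverse preserve siblings, each coordinate has one image, and different
coordinates have different ones. -/
theorem exists_sib_perm (φ : G ≃g G) (x : HProd h) :
    ∃ τ : Equiv.Perm (Fin d), ∀ j y, Sib p j x y → Sib p (τ j) (φ x) (φ y) := by
  have hp := fun j => (H j).height_parent
  have key : ∀ j, ∃ j', ∀ y, Sib p j x y → Sib p j' (φ x) (φ y) := by
    intro j
    obtain ⟨y, hy⟩ := exists_sib H hk j x
    obtain ⟨j', hj'⟩ := hy.map hG H hd hk φ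
    refine ⟨j', fun z hz => ?_⟩
    by_cases hyz : y = z
    · rw [← hyz]; exact hj'
    · obtain ⟨l, hl⟩ := hz.map hG H hd hk φ
      obtain ⟨m, hm⟩ := (hy.trans hz hyz).map hG H hd hk φ
      rwa [hj'.eq_of_sib hl hm]
  choose τ hτ using key
  have hinj : Function.Injective τ := by
    intro i j hij
    obtain ⟨y, hy⟩ := exists_sib H hk i x
    obtain ⟨z, hz⟩ := exists_sib H hk j x
    have hy' := hτ i y hy
    have hz' := hτ j z hz
    rw [hij] at hy'
    by_cases hyz : y = z
    · subst hyz
      by_contra hne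
      exact hy.1 (hz.2.2 i hne).symm
    · obtain ⟨l, hl⟩ := (hy'.trans hz' (φ.injective.ne hyz)).map hG H hd hk φ.symm
      rw [RelIso.symm_apply_apply, RelIso.symm_apply_apply] at hl
      exact hy.eq_of_sib hz hl
  exact ⟨Equiv.ofBijective τ (Finite.injective_iff_bijective.1 hinj), hτ⟩

/-- Every automorphism of the horocyclic product permutes the types of the edges. -/
theorem exists_twist (φ : G ≃g G) : ∃ τ : Equiv.Perm (Fin d),
    Twist p φ τ ∧ ∀ j x y, Sib p j x y → Sib p (τ j) (φ x) (φ y) := by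
  have hp := fun j => (H j).height_parent
  choose τ hτ using exists_sib_perm hG H hd hk φ
  have adj : ∀ {a b x y}, Up p a b x y → G.Adj x y := fun u => (hG _ _).2 ⟨_, _, u⟩
  -- Replacing `x` by a sibling in the climbing coordinate `i` keeps `y` a neighbour; for the images
  -- this is only possible in the climbing coordinate `i'`.
  have aux : ∀ {i j x y i' j'}, Up p i j x y → Up p i' j' (φ x) (φ y) → τ x i = i' := by
    intro i j x y i' j' u v
    obtain ⟨x', hx'⟩ := exists_sib H hk i x
    have u' : Up p i j x' y := by
      refine ⟨u.1, by rw [u.2.1, hx'.2.1], by rw [u.2.2.1, hx'.2.2 j u.1.symm], fun m h1 h2 => ?_⟩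
      rw [u.2.2.2 m h1 h2, hx'.2.2 m h1]
    obtain ⟨a, b, w⟩ := (hG _ _).1 (φ.map_adj_iff.2 (adj u'))
    exact Sib.eq_of_up hp v (hτ x i x' hx') w
  -- The same move made from a sibling of `x` in an unmoved coordinate `l` leads to a sibling of `y`
  -- in `l`; `φ` preserves this square of two edges and two sibling pairs.
  have aux' : ∀ {i j x y i' j'}, Up p i j x y → Up p i' j' (φ x) (φ y) →
      ∀ l, l ≠ i → l ≠ j → τ y l = τ x l := by
    intro i j x y i' j' u v l hi hj
    obtain ⟨x', hx'⟩ := exists_sib H hk l x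
    obtain ⟨c, hc⟩ : ∃ c, p j c = x'.1 j :=
      (H j).exists_child (by have := hk j; omega) _
    have hc' : p j (y.1 j) = x'.1 j := by rw [u.2.2.1, hx'.2.2 j (Ne.symm hj)]
    obtain ⟨y', u', hy'⟩ := exists_up H u.1 x' hc'
    have hs : Sib p l y y' := by
      refine ⟨?_, ?_, fun m hm => ?_⟩
      · rw [u.2.2.2 l hi hj, u'.2.2.2 l hi hj]; exact hx'.1
      · rw [u.2.2.2 l hi hj, u'.2.2.2 l hi hj]; exact hx'.2.1
      · by_cases h1 : m = j
        · subst h1; exact hy'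
        by_cases h2 : m = i
        · subst h2; rw [u'.2.1, u.2.1, hx'.2.2 m hm]
        · rw [u.2.2.2 m h2 h1, u'.2.2.2 m h2 h1, hx'.2.2 m hm]
    obtain ⟨a, b, w⟩ := (hG _ _).1 (φ.map_adj_iff.2 (adj u'))
    refine Sib.eq_of_up_up hp v (hτ x l x' hx') (hτ y l y' hs) (fun e => hi ?_) w
    rw [← aux u v] at e
    exact (τ x).injective e
  -- By `aux'` the permutations at `x` and `y` agree off `i` and `j`; `aux`, used for the edge and
  -- its reverse, excludes that they are interchanged there.
  have edge : ∀ {i j x y}, Up p i j x y → τ y = τ x ∧ Up p (τ x i) (τ x j) (φ x) (φ y) := by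
    intro i j x y u
    obtain ⟨i', j', v⟩ := (hG _ _).1 (φ.map_adj_iff.2 (adj u))
    have e1 := aux u v
    have e2 := aux u.symm v.symm
    have e3 := aux' u v
    have hij := v.1
    have e4 : τ y i = τ x i := by
      obtain ⟨m, hm⟩ := (τ y).surjective (τ x i)
      by_cases h1 : m = i
      · rw [← hm, h1]
      by_cases h2 : m = j
      · rw [h2, e1, e2] at hm; exact (hij hm.symm).elim
      · rw [e3 m h1 h2] at hm; exact (h1 ((τ x).injective hm)).elim
    have e5 : τ y j = τ x j := by
      obtain ⟨m, hm⟩ := (τ x).surjective (τ y j)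
      by_cases h1 : m = i
      · rw [h1, e1, e2] at hm; exact (hij hm).elim
      by_cases h2 : m = j
      · rw [← hm, h2]
      · rw [← e3 m h1 h2] at hm; exact (h2 ((τ y).injective hm)).elim
    refine ⟨Equiv.ext fun m => ?_, by rw [e1, ← e5, e2]; exact v⟩
    by_cases h1 : m = i
    · rw [h1, e4]
    by_cases h2 : m = j
    · rw [h2, e5]
    exact e3 m h1 h2
  have const : ∀ x y, τ y = τ x := by
    intro x y
    obtain ⟨w⟩ := hprod_preconnected hG H hd hk x y
    induction w with
    | nil => rfl
    | cons hadj _ ih =>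
      obtain ⟨i, j, u⟩ := (hG _ _).1 hadj
      rw [ih, (edge u).1]
  have : Nontrivial (Fin d) := Fin.nontrivial_iff_two_le.2 hd
  obtain ⟨i, -, -⟩ := exists_pair_ne (Fin d)
  obtain ⟨x0, -⟩ := exists_coord H hd hk i (H i).nonempty.some
  refine ⟨τ x0, fun i j x y u => ?_, fun j x y s => ?_⟩
  · rw [const x x0]; exact (edge u).2
  · rw [const x x0]; exact hτ x j y s

omit hG in
theorem Twist.unique {φ : G ≃g G} {τ σ : Equiv.Perm (Fin d)} (h1 : Twist p φ τ)
    (h2 : Twist p φ σ) : τ = σ := by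
  have hp := fun j => (H j).height_parent
  have : Nontrivial (Fin d) := Fin.nontrivial_iff_two_le.2 hd
  refine Equiv.ext fun i => ?_
  obtain ⟨j, hj⟩ := exists_ne i
  obtain ⟨x, -⟩ := exists_coord H hd hk i (H i).nonempty.some
  obtain ⟨c, hc⟩ := (H j).exists_child (by have := hk j; omega) (x.1 j)
  obtain ⟨y, u, -⟩ := exists_up H hj.symm x hc
  exact ((h2 i j x y u).unique hp (h1 i j x y u)).1

omit hG H hd hk in
theorem Twist.one : Twist p (1 : G ≃g G) 1 := fun _ _ _ _ u => u

omit hG H hd hk in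
theorem Twist.mul {φ ψ : G ≃g G} {τ σ : Equiv.Perm (Fin d)} (h1 : Twist p φ τ)
    (h2 : Twist p ψ σ) : Twist p (φ * ψ) (τ * σ) := fun i j x y u => h1 _ _ _ _ (h2 i j x y u)

theorem Twist.inv {φ : G ≃g G} {τ : Equiv.Perm (Fin d)} (h1 : Twist p φ τ) :
    Twist p φ⁻¹ τ⁻¹ := by
  obtain ⟨σ, hσ, -⟩ := exists_twist hG H hd hk φ⁻¹
  have := (h1.mul hσ).unique H hd hk (by rw [mul_inv_cancel]; exact Twist.one)
  rwa [inv_eq_of_mul_eq_one_right this]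

omit hG hd in
/-- An automorphism acts on the coordinates separately. -/
theorem Twist.coord_eq {φ : G ≃g G} {τ : Equiv.Perm (Fin d)} (ht : Twist p φ τ) (i : Fin d) :
    ∀ x y : HProd h, x.1 i = y.1 i → (φ x).1 (τ i) = (φ y).1 (τ i) := by
  refine coord_induction H hk i (fun x y => (φ x).1 (τ i) = (φ y).1 (τ i)) (fun x => rfl) ?_
  -- Coordinate `i` of `x` is the parent of that of `x'`, and `φ` carries this relation to
  -- coordinate `τ i`.
  intro a b x x' y y' _ _ hx hy _ r
  have h1 := (ht _ _ _ _ hx).2.2.1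
  have h2 := (ht _ _ _ _ hy).2.2.1
  rw [← h1, ← h2, r]

/-- The coordinate maps of an automorphism. -/
theorem Twist.exists_coord_map {φ : G ≃g G} {τ : Equiv.Perm (Fin d)} (ht : Twist p φ τ)
    (i : Fin d) : ∃ g : W i → W (τ i), (∀ x : HProd h, (φ x).1 (τ i) = g (x.1 i)) ∧
      (∀ v, g (p i v) = p (τ i) (g v)) ∧ Function.Injective g := by
  have : Nontrivial (Fin d) := Fin.nontrivial_iff_two_le.2 hd
  choose s hs using exists_coord H hd hk i
  have hg : ∀ x : HProd h, (φ x).1 (τ i) = (φ (s (x.1 i))).1 (τ i) :=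
    fun x => ht.coord_eq H hk i _ _ (hs _).symm
  refine ⟨fun v => (φ (s v)).1 (τ i), hg, fun v => ?_, fun v w e => ?_⟩
  · obtain ⟨j, hj⟩ := exists_ne i
    obtain ⟨c, hc⟩ := (H j).exists_child (by have := hk j; omega) ((s v).1 j)
    obtain ⟨y, u, -⟩ := exists_up H hj.symm (s v) hc
    have e := (ht i j _ _ u).2.1
    rw [hg y, u.2.1, hs v] at e
    exact e
  · have := (ht.inv hG H hd hk).coord_eq H hk (τ i) _ _ e
    have e1 : ∀ z : HProd h, φ⁻¹ (φ z) = z := φ.symm_apply_apply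
    rw [e1, e1, show τ⁻¹ (τ i) = i from τ.symm_apply_apply i, hs, hs] at this
    exact this

theorem Twist.children_eq {φ : G ≃g G} {τ : Equiv.Perm (Fin d)} (ht : Twist p φ τ) (i : Fin d) :
    k (τ i) = k i := by
  have le : ∀ {φ : G ≃g G} {τ : Equiv.Perm (Fin d)}, Twist p φ τ → ∀ i, k i ≤ k (τ i) := by
    intro φ τ ht i
    obtain ⟨g, -, hgp, ginj⟩ := ht.exists_coord_map hG H hd hk i
    obtain ⟨v⟩ := (H i).nonempty
    rw [← (H i).ncard_children v, ← (H (τ i)).ncard_children (g v),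
      ← Set.ncard_image_of_injective _ ginj]
    refine Set.ncard_le_ncard ?_ ((H (τ i)).finite_children (by have := hk (τ i); omega) _)
    rintro _ ⟨w, hw, rfl⟩
    change p _ (g w) = g v
    rw [← hgp, show p i w = v from hw]
  refine le_antisymm ?_ (le ht i)
  have := le (ht.inv hG H hd hk) (τ i)
  rwa [show τ⁻¹ (τ i) = i from τ.symm_apply_apply i] at this

end
end Product
-- The parent map and the Busemann function of a tree with an end
section Tree

variable {V : Type*} {T : SimpleGraph V}

theorem Ray.dist_eq (s : Ray T) {m n : ℕ} (h : m ≤ n) :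
    T.dist (s.toFun n) (s.toFun m) = n - m := by
  obtain ⟨k, rfl⟩ := Nat.exists_eq_add_of_le h
  rw [SimpleGraph.dist_comm, s.geodesic]; omega

theorem Ray.adj (s : Ray T) (n : ℕ) : T.Adj (s.toFun n) (s.toFun (n + 1)) :=
  SimpleGraph.dist_eq_one_iff_adj.1 (s.geodesic n 1)

theorem Ray.injective (s : Ray T) : Function.Injective s.toFun := by
  have key : ∀ m n, m < n → s.toFun m ≠ s.toFun n := fun m n h e => by
    have := s.dist_eq h.le
    rw [e, SimpleGraph.dist_self] at this
    omega
  intro m n e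
  rcases lt_trichotomy m n with h | h | h
  · exact (key m n h e).elim
  · exact h
  · exact (key n m h e.symm).elim

theorem eq_of_closer (hT : T.IsTree) {x y y' z : V} (h1 : T.Adj x y) (h2 : T.Adj x y')
    (d1 : T.dist z x = T.dist z y + 1) (d2 : T.dist z x = T.dist z y' + 1) : y = y' := by
  obtain ⟨w, hw⟩ := hT.connected.exists_walk_length_eq_dist y z
  obtain ⟨w', hw'⟩ := hT.connected.exists_walk_length_eq_dist y' z
  have p1 : (SimpleGraph.Walk.cons h1 w).IsPath := SimpleGraph.Walk.isPath_of_length_eq_dist _ (by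
    rw [SimpleGraph.Walk.length_cons, hw, T.dist_comm, T.dist_comm (u := x), d1])
  have p2 : (SimpleGraph.Walk.cons h2 w').IsPath := SimpleGraph.Walk.isPath_of_length_eq_dist _ (by
    rw [SimpleGraph.Walk.length_cons, hw', T.dist_comm, T.dist_comm (u := x), d2])
  have e := congrArg Subtype.val ((hT.isAcyclic.subsingleton_path _ _).elim ⟨_, p1⟩ ⟨_, p2⟩)
  have := congrArg SimpleGraph.Walk.snd e
  simpa using this

theorem exists_closer (hT : T.IsTree) {x z : V} (h : x ≠ z) :
    ∃ y, T.Adj x y ∧ T.dist z x = T.dist z y + 1 := by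
  obtain ⟨w, hw⟩ := hT.connected.exists_walk_length_eq_dist x z
  cases w with
  | nil => exact (h rfl).elim
  | @cons _ y _ ha w =>
    refine ⟨y, ha, ?_⟩
    rw [SimpleGraph.Walk.length_cons] at hw
    have h1 := SimpleGraph.dist_le w
    rw [T.dist_comm (u := y)] at h1
    rw [T.dist_comm (u := x)] at hw
    rcases hT.dist_eq_dist_add_one_of_adj z ha with h2 | h2 <;> omega

/-- From time `n` on the ray `s` moves away from `x`. -/
def Leaves (s : Ray T) (x : V) (n : ℕ) : Prop :=
  T.dist (s.toFun (n + 1)) x = T.dist (s.toFun n) x + 1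

/-- `y` is the neighbour of `x` in the direction of the end of the ray `s`. -/
def Toward (s : Ray T) (x y : V) : Prop :=
  ∃ n, Leaves s x n ∧ T.Adj x y ∧ T.dist (s.toFun n) x = T.dist (s.toFun n) y + 1

section

variable (hT : T.IsTree) (s : Ray T)
include hT

/-- If the ray turned back towards `x` at time `n + 1`, its vertices at times `n` and `n + 2` would
both be the unique neighbour closer to `x`. -/
theorem Leaves.succ {s : Ray T} {x : V} {n : ℕ} (hn : Leaves s x n) : Leaves s x (n + 1) := by
  unfold Leaves at *
  rcases hT.dist_eq_dist_add_one_of_adj x (s.adj (n + 1)) with h | h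
  · rw [T.dist_comm, T.dist_comm (v := s.toFun (n + 1 + 1))] at h
    have := eq_of_closer hT (z := x) (s.adj n).symm (s.adj (n + 1))
      (by rw [T.dist_comm, hn, T.dist_comm]) (by rw [T.dist_comm, h, T.dist_comm])
    have := s.injective this
    omega
  · rw [T.dist_comm, h, T.dist_comm]

theorem Leaves.mono {s : Ray T} {x : V} {m n : ℕ} (hm : Leaves s x m) (hmn : m ≤ n) :
    Leaves s x n := by
  induction n, hmn using Nat.le_induction with
  | base => exact hm
  | succ n _ ih => exact ih.succ hT

theorem Leaves.dist_eq {s : Ray T} {x : V} {m : ℕ} (hm : Leaves s x m) (k : ℕ) :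
    T.dist (s.toFun (m + k)) x = T.dist (s.toFun m) x + k := by
  induction k with
  | zero => rfl
  | succ k ih =>
    have := hm.mono hT (Nat.le_add_right m k)
    unfold Leaves at this
    rw [← add_assoc, this, ih, add_assoc]

theorem exists_leaves (x : V) : ∃ n, Leaves s x n := by
  by_contra hcon
  push Not at hcon
  have key : ∀ n, T.dist (s.toFun n) x + n = T.dist (s.toFun 0) x := by
    intro n
    induction n with
    | zero => rfl
    | succ n ih =>
      rcases hT.dist_eq_dist_add_one_of_adj x (s.adj n) with h | h
      · rw [T.dist_comm, T.dist_comm (u := x)] at h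
        omega
      · rw [T.dist_comm, T.dist_comm (u := x)] at h
        exact (hcon n h).elim
  have := key (T.dist (s.toFun 0) x + 1)
  omega

theorem Leaves.of_closer {s : Ray T} {x y : V} {n : ℕ} (hn : Leaves s x n) (ha : T.Adj x y)
    (hd : T.dist (s.toFun n) x = T.dist (s.toFun n) y + 1) :
    Leaves s y n ∧ T.dist (s.toFun (n + 1)) x = T.dist (s.toFun (n + 1)) y + 1 := by
  unfold Leaves at *
  have h1 := hT.dist_eq_dist_add_one_of_adj (s.toFun (n + 1)) ha
  have h2 := hT.dist_eq_dist_add_one_of_adj y (s.adj n)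
  rw [T.dist_comm, T.dist_comm (u := y)] at h2
  omega

theorem Leaves.closer_mono {s : Ray T} {x y : V} {m n : ℕ} (hm : Leaves s x m) (ha : T.Adj x y)
    (hd : T.dist (s.toFun m) x = T.dist (s.toFun m) y + 1) (hmn : m ≤ n) :
    T.dist (s.toFun n) x = T.dist (s.toFun n) y + 1 := by
  induction n, hmn using Nat.le_induction with
  | base => exact hd
  | succ n hmn ih => exact ((hm.mono hT hmn).of_closer hT ha ih).2

theorem Toward.unique {s : Ray T} {x y y' : V} (h1 : Toward s x y) (h2 : Toward s x y') :
    y = y' := by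
  obtain ⟨n, a1, a2, a3⟩ := h1
  obtain ⟨n', b1, b2, b3⟩ := h2
  exact eq_of_closer hT a2 b2 (a1.closer_mono hT a2 a3 (le_max_left n n'))
    (b1.closer_mono hT b2 b3 (le_max_right n n'))

theorem exists_toward (x : V) : ∃ y, Toward s x y := by
  obtain ⟨n, hn⟩ := exists_leaves hT s x
  have hne : x ≠ s.toFun (n + 1) := by
    rintro e
    unfold Leaves at hn
    rw [← e, T.dist_self] at hn
    omega
  obtain ⟨y, h1, h2⟩ := exists_closer hT hne
  exact ⟨y, n + 1, hn.succ hT, h1, h2⟩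

theorem toward_of_adj {x y : V} (ha : T.Adj x y) : Toward s x y ∨ Toward s y x := by
  obtain ⟨m, hm⟩ := exists_leaves hT s x
  obtain ⟨n, hn⟩ := exists_leaves hT s y
  rcases hT.dist_eq_dist_add_one_of_adj (s.toFun (max m n)) ha with h | h
  · exact Or.inl ⟨_, hm.mono hT (le_max_left m n), ha, h⟩
  · exact Or.inr ⟨_, hn.mono hT (le_max_right m n), ha.symm, h⟩

omit hT in
theorem toward_ray (n : ℕ) : Toward s (s.toFun n) (s.toFun (n + 1)) := by
  refine ⟨n + 1, ?_, s.adj n, ?_⟩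
  · unfold Leaves
    rw [s.dist_eq (by omega), s.dist_eq (by omega)]; omega
  · rw [s.dist_eq (by omega), T.dist_self]; omega

end

/-- The parent of `x` with respect to the end `ω`: the second vertex of the ray which starts at `x`
and represents `ω`. -/
noncomputable def parent (ω : TreeEnd T) (x : V) : V :=
  @Classical.epsilon V ⟨x⟩ fun y =>
    ∃ r : Ray T, Quotient.mk (rayEquiv T) r = ω ∧ r.toFun 0 = x ∧ r.toFun 1 = y

section

variable (hT : T.IsTree) {s : Ray T} {p : V → V} (hp : ∀ x, Toward s x (p x))
include hT hp

/-- Once the ray leaves `x`, the direction of its end is that of `s.toFun n`, so iterating `p`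
follows the geodesic to this vertex. -/
theorem Leaves.iterate {x : V} {n k : ℕ} (hn : Leaves s x n) (hk : k ≤ T.dist (s.toFun n) x) :
    Leaves s (p^[k] x) n ∧ T.dist (s.toFun n) x = T.dist (s.toFun n) (p^[k] x) + k := by
  induction k with
  | zero => exact ⟨hn, rfl⟩
  | succ k ih =>
    obtain ⟨h1, h2⟩ := ih (by omega)
    have hne : p^[k] x ≠ s.toFun n := by
      intro e
      rw [e, T.dist_self] at h2
      omega
    obtain ⟨y, h3, h4⟩ := exists_closer hT hne
    have e : p (p^[k] x) = y := (hp _).unique hT ⟨n, h1, h3, h4⟩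
    rw [Function.iterate_succ_apply', e]
    exact ⟨(h1.of_closer hT h3 h4).1, by omega⟩

theorem Leaves.iterate_eq {x : V} {n : ℕ} (hn : Leaves s x n) :
    p^[T.dist (s.toFun n) x] x = s.toFun n := by
  have := (hn.iterate hT hp le_rfl).2
  exact ((hT.connected.dist_eq_zero_iff).1 (by omega)).symm

theorem dist_iterate (x : V) (k : ℕ) : T.dist x (p^[k] x) = k := by
  obtain ⟨n, hn⟩ := exists_leaves hT s x
  have h1 := ((hn.mono hT (Nat.le_add_right n k)).iterate hT hp (k := k)
    (by rw [hn.dist_eq hT]; omega)).2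
  have h2 : T.dist x (p^[k] x) ≤ k := by
    clear h1
    induction k with
    | zero => simp
    | succ k ih =>
      obtain ⟨m, -, ha, -⟩ := hp (p^[k] x)
      have := hT.connected.dist_triangle (u := x) (v := p^[k] x) (w := p (p^[k] x))
      rw [SimpleGraph.dist_eq_one_iff_adj.2 ha] at this
      rw [Function.iterate_succ_apply']
      omega
  have h3 := hT.connected.dist_triangle (u := s.toFun (n + k)) (v := p^[k] x) (w := x)
  rw [T.dist_comm (u := p^[k] x)] at h3
  omega

theorem iterate_ray (n m : ℕ) : p^[m] (s.toFun n) = s.toFun (n + m) := by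
  induction m with
  | zero => rfl
  | succ m ih =>
    rw [Function.iterate_succ_apply', ih]
    exact (hp _).unique hT (toward_ray s _)

/-- The ray obtained by iterating the parent map. -/
theorem exists_ray (x : V) : ∃ r : Ray T, (∀ n, r.toFun n = p^[n] x) ∧
    Quotient.mk (rayEquiv T) r = Quotient.mk (rayEquiv T) s := by
  let r : Ray T := ⟨fun n => p^[n] x, fun m n => by
    rw [add_comm, Function.iterate_add_apply, dist_iterate hT hp]⟩
  refine ⟨r, fun n => rfl, Quotient.sound ?_⟩
  obtain ⟨n, hn⟩ := exists_leaves hT s x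
  have he : ∀ m, p^[m + T.dist (s.toFun n) x] x = s.toFun (n + m) := fun m => by
    rw [Function.iterate_add_apply, hn.iterate_eq hT hp, iterate_ray hT hp]
  refine Set.Finite.subset (((Set.finite_Iio (T.dist (s.toFun n) x)).image r.toFun).union
    ((Set.finite_Iio n).image s.toFun)) ?_
  rintro _ (⟨⟨m, rfl⟩, h2⟩ | ⟨⟨m, rfl⟩, h2⟩)
  · refine Or.inl ⟨m, ?_, rfl⟩
    by_contra hlt
    simp only [Set.mem_Iio, not_lt] at hlt
    obtain ⟨l, rfl⟩ := Nat.exists_eq_add_of_le' hlt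
    exact h2 ⟨_, (he l).symm⟩
  · refine Or.inr ⟨m, ?_, rfl⟩
    by_contra hlt
    simp only [Set.mem_Iio, not_lt] at hlt
    obtain ⟨l, rfl⟩ := Nat.exists_eq_add_of_le hlt
    exact h2 ⟨_, he l⟩

/-- Equivalent rays meet at times that are late on both, and the next vertex of a geodesic is the
neighbour closer to the meeting point. So a ray representing the end is determined by its start, and
the choice in `parent` is harmless. -/
theorem Ray.eq_iterate {r : Ray T}
    (hr : Quotient.mk (rayEquiv T) r = Quotient.mk (rayEquiv T) s) (n : ℕ) :
    r.toFun n = p^[n] (r.toFun 0) := by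
  have hfin : (symmDiff (Set.range r.toFun) (Set.range s.toFun)).Finite := Quotient.exact hr
  have step : ∀ i, r.toFun (i + 1) = p (r.toFun i) := by
    intro i
    obtain ⟨n0, hn0⟩ := exists_leaves hT s (r.toFun i)
    have hbad : (r.toFun ⁻¹' (symmDiff (Set.range r.toFun) (Set.range s.toFun) ∪
        s.toFun '' Set.Iio n0) ∪ Set.Iic i).Finite :=
      ((hfin.union ((Set.finite_Iio n0).image _)).preimage r.injective.injOn).union
        (Set.finite_Iic i)
    obtain ⟨m, hm⟩ := hbad.infinite_compl.nonempty
    simp only [Set.mem_compl_iff, Set.mem_union, Set.mem_preimage, Set.mem_Iic, not_or, not_le]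
      at hm
    obtain ⟨⟨h1, h2⟩, h3⟩ := hm
    have h4 : r.toFun m ∈ Set.range s.toFun := by
      by_contra h
      exact h1 (Or.inl ⟨⟨m, rfl⟩, h⟩)
    obtain ⟨n, hn⟩ := h4
    have h5 : n0 ≤ n := by
      by_contra h
      exact h2 ⟨n, by simpa using h, hn⟩
    refine (Toward.unique hT ⟨n, hn0.mono hT h5, r.adj i, ?_⟩ (hp _))
    rw [hn, r.dist_eq (by omega), r.dist_eq (by omega)]
    omega
  induction n with
  | zero => rfl
  | succ n ih => rw [step, ih, Function.iterate_succ_apply']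

end

section

variable (hT : T.IsTree) (ω : TreeEnd T)
include hT

theorem exists_parent : ∃ s : Ray T, Quotient.mk (rayEquiv T) s = ω ∧
    ∀ x, Toward s x (parent ω x) := by
  obtain ⟨s, rfl⟩ := Quotient.exists_rep ω
  refine ⟨s, rfl, ?_⟩
  choose p hp using exists_toward hT s
  have : p = parent (Quotient.mk (rayEquiv T) s) := by
    funext x
    obtain ⟨r, h1, h2⟩ := exists_ray hT hp x
    obtain ⟨r', h3, h4, h5⟩ := @Classical.epsilon_spec V (fun y => ∃ r : Ray T,
      Quotient.mk (rayEquiv T) r = Quotient.mk (rayEquiv T) s ∧ r.toFun 0 = x ∧ r.toFun 1 = y)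
      ⟨p x, r, h2, h1 0, h1 1⟩
    have := Ray.eq_iterate hT hp h3 1
    rw [h4] at this
    exact (h5.symm.trans this).symm
  rw [← this]
  exact hp

theorem adj_iff_parent (x y : V) : T.Adj x y ↔ y = parent ω x ∨ x = parent ω y := by
  obtain ⟨s, -, hp⟩ := exists_parent hT ω
  constructor
  · intro ha
    rcases toward_of_adj hT s ha with h | h
    · exact Or.inl (h.unique hT (hp x))
    · exact Or.inr (h.unique hT (hp y))
  · rintro (rfl | rfl)
    · obtain ⟨_, _, ha, _⟩ := hp x
      exact ha
    · obtain ⟨_, _, ha, _⟩ := hp y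
      exact ha.symm

theorem ancestor_iff (z x : V) : Ancestor ω z x ↔ ∃ k, z = (parent ω)^[k] x := by
  obtain ⟨s, hs, hp⟩ := exists_parent hT ω
  constructor
  · rintro ⟨r, hr, rfl, k, rfl⟩
    exact ⟨k, Ray.eq_iterate hT hp (hr.trans hs.symm) k⟩
  · rintro ⟨k, rfl⟩
    obtain ⟨r, h1, h2⟩ := exists_ray hT hp x
    exact ⟨r, h2.trans hs, h1 0, k, h1 k⟩

/-- Rays to `ω` are the orbits of the parent map, so preserving `ω` amounts to preserving the first
step of each of them. -/
theorem mem_aff_iff (g : T ≃g T) : g ∈ Aff ω ↔ ∀ x, g (parent ω x) = parent ω (g x) := by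
  obtain ⟨s, hs, hp⟩ := exists_parent hT ω
  have key : g ∈ Aff ω ↔ ∀ r : Ray T, Quotient.mk (rayEquiv T) r = ω →
      Quotient.mk (rayEquiv T) (r.map g) = ω := by
    constructor
    · rintro h r rfl
      exact h
    · intro h
      have := h s hs
      rw [← hs] at this ⊢
      exact this
  rw [key]
  constructor
  · intro h x
    obtain ⟨r, h1, h2⟩ := exists_ray hT hp x
    have := Ray.eq_iterate hT hp ((h r (h2.trans hs)).trans hs.symm) 1
    change g (r.toFun 1) = parent ω (g (r.toFun 0)) at this
    rwa [h1, h1] at this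
  · intro h r hr
    obtain ⟨r', h1, h2⟩ := exists_ray hT hp (g (r.toFun 0))
    have comm : ∀ n x, g ((parent ω)^[n] x) = (parent ω)^[n] (g x) := by
      intro n
      induction n with
      | zero => exact fun x => rfl
      | succ n ih => exact fun x => by rw [Function.iterate_succ_apply, ih, h]; rfl
    have : r.map g = r' := by
      have e : (r.map g).toFun = r'.toFun := by
        funext n
        rw [h1, ← comm, ← Ray.eq_iterate hT hp (hr.trans hs.symm)]
        rfl
      cases r'; cases e; rfl
    rw [this, h2, hs]

theorem isHoroTree_of_isTree {q : ℕ} (o : V)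
    (hdeg : ∀ v, (T.neighborSet v).ncard = q + 1) : IsHoroTree (parent ω) (hor ω o) q := by
  obtain ⟨s, hs, hp⟩ := exists_parent hT ω
  -- The Busemann function read off along `s`: the difference is constant once the ray leaves `x`.
  have hh : ∀ x, ∃ c : ℤ, ∀ n, Leaves s x n → (T.dist (s.toFun n) x : ℤ) - n = c := by
    intro x
    obtain ⟨m, hm⟩ := exists_leaves hT s x
    refine ⟨(T.dist (s.toFun m) x : ℤ) - m, fun n hn => ?_⟩
    rcases le_total m n with h | h
    · obtain ⟨k, rfl⟩ := Nat.exists_eq_add_of_le h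
      rw [hm.dist_eq hT]; push_cast; ring
    · obtain ⟨k, rfl⟩ := Nat.exists_eq_add_of_le h
      rw [hn.dist_eq hT]; push_cast; ring
  choose b hb using hh
  have b_parent : ∀ x, b (parent ω x) = b x - 1 := by
    intro x
    obtain ⟨n, h1, h2, h3⟩ := hp x
    rw [← hb x n h1, ← hb _ n (h1.of_closer hT h2 h3).1, h3]
    push_cast; ring
  have b_iter : ∀ n x, b ((parent ω)^[n] x) = b x - n := by
    intro n
    induction n with
    | zero => simp
    | succ n ih => intro x; rw [Function.iterate_succ_apply, ih, b_parent]; push_cast; ring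
  have common : ∀ x y, ∃ m n : ℕ, (parent ω)^[m] x = (parent ω)^[n] y := by
    intro x y
    obtain ⟨m, hm⟩ := exists_leaves hT s x
    obtain ⟨n, hn⟩ := exists_leaves hT s y
    exact ⟨_, _, ((hm.mono hT (le_max_left m n)).iterate_eq hT hp).trans
      ((hn.mono hT (le_max_right m n)).iterate_eq hT hp).symm⟩
  -- The common ancestor the fewest steps above `x` is maximal, so the choice in `confluent` has
  -- something to choose.
  have conf : ∀ x y, ∃ m n : ℕ, confluent ω x y = (parent ω)^[m] x ∧
      confluent ω x y = (parent ω)^[n] y ∧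
      ∀ a b : ℕ, (parent ω)^[a] x = (parent ω)^[b] y → m ≤ a := by
    classical
    intro x y
    have hex : ∃ z, IsConfluent ω x y z := by
      let m := Nat.find (common x y)
      obtain ⟨n, hn⟩ : ∃ n, (parent ω)^[m] x = (parent ω)^[n] y := Nat.find_spec (common x y)
      refine ⟨(parent ω)^[m] x, (ancestor_iff hT ω _ _).2 ⟨m, rfl⟩,
        (ancestor_iff hT ω _ _).2 ⟨n, hn⟩, fun w h1 h2 => ?_⟩
      obtain ⟨a, ha⟩ := (ancestor_iff hT ω _ _).1 h1
      obtain ⟨c, hc⟩ := (ancestor_iff hT ω _ _).1 h2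
      have hma : m ≤ a := Nat.find_min' (common x y) ⟨c, ha.symm.trans hc⟩
      obtain ⟨l, rfl⟩ := Nat.exists_eq_add_of_le' hma
      exact (ancestor_iff hT ω _ _).2 ⟨l, by rw [ha, Function.iterate_add_apply]⟩
    obtain ⟨h1, h2, h3⟩ : IsConfluent ω x y (confluent ω x y) :=
      @Classical.epsilon_spec V (IsConfluent ω x y) hex
    obtain ⟨m, hm⟩ := (ancestor_iff hT ω _ _).1 h1
    obtain ⟨n, hn⟩ := (ancestor_iff hT ω _ _).1 h2
    refine ⟨m, n, hm, hn, fun a c hac => ?_⟩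
    obtain ⟨l, hl⟩ := (ancestor_iff hT ω _ _).1
      (h3 ((parent ω)^[a] x) ((ancestor_iff hT ω _ _).2 ⟨a, rfl⟩)
        ((ancestor_iff hT ω _ _).2 ⟨c, hac⟩))
    have e := congrArg b hl
    rw [hm, b_iter, b_iter, b_iter] at e
    omega
  -- The confluents of `x, o` and of `o, x` are separate choices; minimality of both makes the step
  -- counts match.
  have hor_eq : ∀ x, hor ω o x = b x - b o := by
    intro x
    obtain ⟨m, n, h1, h2, h3⟩ := conf x o
    obtain ⟨n', m', h4, h5, h6⟩ := conf o x
    have a1 := h3 m' n' (h5.symm.trans h4)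
    have a2 := h6 n m (h2.symm.trans h1)
    have e1 := congrArg b (h1.symm.trans h2)
    have e2 := congrArg b (h4.symm.trans h5)
    rw [b_iter, b_iter] at e1 e2
    unfold hor up
    rw [h1, h4, dist_iterate hT hp, dist_iterate hT hp]
    omega
  refine ⟨⟨o⟩, fun x => by rw [hor_eq, hor_eq, b_parent]; ring, common, fun x => ?_⟩
  have hne : parent ω x ∉ {y | parent ω y = x} := by
    intro h
    have e := b_parent (parent ω x)
    rw [show parent ω (parent ω x) = x from h, b_parent] at e
    omega
  have hset : T.neighborSet x = insert (parent ω x) {y | parent ω y = x} := by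
    ext y
    rw [SimpleGraph.mem_neighborSet, adj_iff_parent hT ω]
    simp [eq_comm]
  have hfin : {y | parent ω y = x}.Finite := by
    refine (Set.finite_of_ncard_ne_zero (s := T.neighborSet x) (by rw [hdeg]; omega)).subset ?_
    rw [hset]; exact Set.subset_insert _ _
  have := hdeg x
  rw [hset, Set.ncard_insert_of_notMem hne hfin] at this
  omega

end

end Tree

/-! ### Homogeneity of the tree and transitivity on the product -/

namespace IsHoroTree

variable {W : Type*} {p : W → W} {h : W → ℤ} {k : ℕ} (H : IsHoroTree p h k)
include H

theorem exists_common_of_height {x y : W} (hxy : h x = h y) : ∃ n : ℕ, p^[n] x = p^[n] y := by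
  obtain ⟨m, n, e⟩ := H.exists_common x y
  have := congrArg h e
  rw [H.height_iterate, H.height_iterate] at this
  obtain rfl : m = n := by omega
  exact ⟨m, e⟩

/-- A labelling of the vertices which identifies the children of any vertex with `Fin k`, and gives
the label `0` to all ancestors of `x`. -/
theorem exists_labelling (hk : 1 ≤ k) (x : W) : ∃ l : W → Fin k,
    (∀ v w, p v = p w → l v = l w → v = w) ∧ (∀ v i, ∃ w, p w = v ∧ l w = i) ∧
      ∀ n, l (p^[n] x) = ⟨0, hk⟩ := by
  classical
  have hcard : ∀ v, Nat.card {w | p w = v} = k := H.ncard_children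
  have ex : ∀ v, ∃ e : {w | p w = v} ≃ Fin k, ∀ w : {w | p w = v}, (∃ n, w.1 = p^[n] x) →
      e w = ⟨0, hk⟩ := by
    intro v
    have : Finite {w | p w = v} := (H.finite_children hk v).to_subtype
    let e0 : {w | p w = v} ≃ Fin k := Finite.equivFinOfCardEq (hcard v)
    by_cases hw : ∃ w : {w | p w = v}, ∃ n, w.1 = p^[n] x
    · obtain ⟨w, n, hn⟩ := hw
      -- By heights, `v` has at most one child on the ray from `x`; the swap gives it the label `0`.
      refine ⟨e0.trans (Equiv.swap (e0 w) ⟨0, hk⟩), ?_⟩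
      rintro w' ⟨n', hn'⟩
      have hww : w' = w := by
        have e1 := H.height_parent w.1
        have e2 := H.height_parent w'.1
        rw [show p w.1 = v from w.2, hn, H.height_iterate] at e1
        rw [show p w'.1 = v from w'.2, hn', H.height_iterate] at e2
        obtain rfl : n = n' := by omega
        exact Subtype.ext (hn'.trans hn.symm)
      rw [hww, Equiv.trans_apply, Equiv.swap_apply_left]
    · exact ⟨e0, fun w h => (hw ⟨w, h⟩).elim⟩
  choose e he using ex
  have hl : ∀ (v w : W) (hw : p w = v), e (p w) ⟨w, rfl⟩ = e v ⟨w, hw⟩ := by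
    rintro v w rfl; rfl
  refine ⟨fun w => e (p w) ⟨w, rfl⟩, fun v w hp hvw => ?_, fun v i => ?_, fun n => ?_⟩
  · replace hvw := (hl _ v hp).symm.trans hvw
    exact congrArg Subtype.val ((e (p w)).injective hvw)
  · obtain ⟨w, hw⟩ := (e v).surjective i
    exact ⟨w.1, w.2, (hl v w.1 w.2).trans hw⟩
  · exact he _ _ ⟨n, rfl⟩

/-- A coordinate system on the tree: vertices correspond to a height and an eventually vanishing
sequence of labels. -/
theorem exists_coordinates (hk : 1 ≤ k) (x : W) : ∃ L : W → ℕ → Fin k,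
    (∀ v n, L (p v) n = L v (n + 1)) ∧ (∀ n, L x n = ⟨0, hk⟩) ∧
    (∀ v w, h v = h w → L v = L w → v = w) ∧
    (∀ v, ∃ N, ∀ n, N ≤ n → L v n = ⟨0, hk⟩) ∧
    ∀ (c : ℤ) (s : ℕ → Fin k) (N : ℕ), (∀ n, N ≤ n → s n = ⟨0, hk⟩) → ∃ v, h v = c ∧ L v = s := by
  obtain ⟨l, l1, l2, l3⟩ := H.exists_labelling hk x
  refine ⟨fun v n => l (p^[n] v), fun v n => congrArg l (Function.iterate_succ_apply p n v).symm, l3,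
    ?_, ?_, ?_⟩
  · intro v w hvw e
    obtain ⟨n, hn⟩ := H.exists_common_of_height hvw
    have : ∀ m, m ≤ n → p^[n - m] v = p^[n - m] w := by
      intro m
      induction m with
      | zero => exact fun _ => hn
      | succ m ih =>
        intro hm
        refine l1 _ _ ?_ (congrFun e _)
        rw [← Function.iterate_succ_apply' p, ← Function.iterate_succ_apply' p,
          show (n - (m + 1)).succ = n - m by omega]
        exact ih (by omega)
    simpa using this n le_rfl
  · intro v
    obtain ⟨m, n, e⟩ := H.exists_common v x
    refine ⟨m, fun i hi => ?_⟩
    obtain ⟨j, rfl⟩ := Nat.exists_eq_add_of_le' hi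
    change l (p^[j + m] v) = _
    rw [Function.iterate_add_apply, e, ← Function.iterate_add_apply, l3]
  · have high : ∀ (m : ℕ) (s : ℕ → Fin k), (∀ n, s n = ⟨0, hk⟩) →
        ∃ v, h v = h x - m ∧ ∀ n, l (p^[n] v) = s n := by
      intro m s hs
      exact ⟨p^[m] x, H.height_iterate m x, fun n => by
        rw [← Function.iterate_add_apply, l3, hs]⟩
    -- The vertex for the shifted sequence, one generation up, has a child with label `s 0`. At `N =
    -- 0` the bound on `c` makes the vertex an ancestor of `x`.
    have low : ∀ (N : ℕ) (c : ℤ) (s : ℕ → Fin k), (∀ n, N ≤ n → s n = ⟨0, hk⟩) → c ≤ h x + N →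
        ∃ v, h v = c ∧ ∀ n, l (p^[n] v) = s n := by
      intro N
      induction N with
      | zero =>
        intro c s hs hc
        obtain ⟨v, h1, h2⟩ := high (h x - c).toNat s (fun n => hs n (Nat.zero_le n))
        exact ⟨v, by rw [h1]; push_cast at hc; omega, h2⟩
      | succ N ih =>
        intro c s hs hc
        obtain ⟨v, h1, h2⟩ := ih (c - 1) (fun n => s (n + 1)) (fun n hn => hs _ (by omega))
          (by push_cast at hc; omega)
        obtain ⟨w, h3, h4⟩ := l2 v (s 0)
        refine ⟨w, ?_, fun n => ?_⟩
        · have := H.height_parent w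
          rw [h3, h1] at this; omega
        · cases n with
          | zero => exact h4
          | succ n => rw [Function.iterate_succ_apply, h3, h2]
    intro c s N hs
    obtain ⟨v, h1, h2⟩ := low (N + (c - h x).toNat) c s (fun n hn => hs n (by omega))
      (by push_cast; omega)
    exact ⟨v, h1, funext h2⟩

/-- The maps commuting with the parent map act transitively. -/
theorem exists_perm (hk : 1 ≤ k) (x y : W) :
    ∃ g : Equiv.Perm W, (∀ v, g (p v) = p (g v)) ∧ g x = y := by
  obtain ⟨L, L1, L2, L3, L4, L5⟩ := H.exists_coordinates hk x
  obtain ⟨M, M1, M2, M3, M4, M5⟩ := H.exists_coordinates hk y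
  -- The permutation matches coordinates based at `x` with coordinates based at `y`; in both systems
  -- the parent map shifts the label sequence.
  have f_ex : ∀ v, ∃ w, h w = h v - h x + h y ∧ M w = L v := fun v => by
    obtain ⟨N, hN⟩ := L4 v
    exact M5 _ _ N hN
  have g_ex : ∀ v, ∃ w, h w = h v - h y + h x ∧ L w = M v := fun v => by
    obtain ⟨N, hN⟩ := M4 v
    exact L5 _ _ N hN
  choose f f1 f2 using f_ex
  choose g g1 g2 using g_ex
  refine ⟨⟨f, g, fun v => ?_, fun v => ?_⟩, fun v => ?_, ?_⟩
  · exact L3 _ _ (by rw [g1, f1]; ring) (by rw [g2, f2])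
  · exact M3 _ _ (by rw [f1, g1]; ring) (by rw [f2, g2])
  · refine M3 _ _ ?_ ?_
    · change h (f (p v)) = h (p (f v))
      rw [f1, H.height_parent, H.height_parent, f1]; ring
    · change M (f (p v)) = M (p (f v))
      funext n
      rw [f2, L1, M1, f2]
  · refine M3 _ _ ?_ ?_
    · change h (f x) = _
      rw [f1]; ring
    · change M (f x) = _
      funext n
      rw [f2, L2, M2]

theorem shift_eq {W' : Type*} {p' : W' → W'} {h' : W' → ℤ} {k' : ℕ} (H' : IsHoroTree p' h' k')
    {g : W → W'} (hg : ∀ v, g (p v) = p' (g v)) (v w : W) : h' (g v) - h v = h' (g w) - h w := by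
  have comm : ∀ (n : ℕ) v, g (p^[n] v) = p'^[n] (g v) := by
    intro n
    induction n with
    | zero => exact fun v => rfl
    | succ n ih => exact fun v => by rw [Function.iterate_succ_apply, ih, hg]; rfl
  obtain ⟨m, n, e⟩ := H.exists_common v w
  have e1 := congrArg h e
  have e2 := congrArg (fun z => h' (g z)) e
  simp only [comm, H'.height_iterate, H.height_iterate] at e1 e2
  omega

end IsHoroTree

section Product

variable {d : ℕ} {W : Fin d → Type*} {p : ∀ j, W j → W j} {h : ∀ j, W j → ℤ} {k : Fin d → ℕ}
  {G : SimpleGraph (HProd h)}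

/-- The automorphism of the horocyclic product given by automorphisms of the factors. -/
theorem exists_prod_aut (hG : ∀ x y, G.Adj x y ↔ ∃ i j, Up p i j x y)
    (g : ∀ j, Equiv.Perm (W j)) (hg : ∀ j v, g j (p j v) = p j (g j v))
    (hs : ∀ x : HProd h, ∑ j, h j (g j (x.1 j)) = 0)
    (hs' : ∀ x : HProd h, ∑ j, h j ((g j).symm (x.1 j)) = 0) :
    ∃ φ : G ≃g G, Twist p φ 1 ∧ ∀ x j, (φ x).1 j = g j (x.1 j) := by
  have hup : ∀ (i j : Fin d) (x y : HProd h), Up p i j x y ↔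
      Up p i j (⟨fun j => g j (x.1 j), hs x⟩ : HProd h) ⟨fun j => g j (y.1 j), hs y⟩ := by
    intro i j x y
    unfold Up
    simp only [← hg, EmbeddingLike.apply_eq_iff_eq]
  let e : HProd h ≃ HProd h :=
    { toFun := fun x => ⟨fun j => g j (x.1 j), hs x⟩
      invFun := fun x => ⟨fun j => (g j).symm (x.1 j), hs' x⟩
      left_inv := fun x => Subtype.ext <| funext fun j => (g j).symm_apply_apply _
      right_inv := fun x => Subtype.ext <| funext fun j => (g j).apply_symm_apply _ }
  refine ⟨⟨e, fun {x y} => ?_⟩, fun i j x y u => (hup i j x y).1 u, fun x j => rfl⟩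
  rw [hG, hG]
  exact exists_congr fun i => exists_congr fun j => (hup i j x y).symm

variable (hG : ∀ x y, G.Adj x y ↔ ∃ i j, Up p i j x y) (H : ∀ j, IsHoroTree (p j) (h j) (k j))
  (hk : ∀ j, 2 ≤ k j)
include hG H hk

/-- The automorphisms acting on the coordinates separately are transitive on tuples of vertices
with given sum of heights. -/
theorem exists_aut_of_sum_eq (a b : ∀ j, W j) (hab : ∑ j, h j (a j) = ∑ j, h j (b j)) :
    ∃ φ : G ≃g G, Twist p φ 1 ∧ ∃ g : ∀ j, W j → W j, (∀ x j, (φ x).1 j = g j (x.1 j)) ∧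
      (∀ j v, g j (p j v) = p j (g j v)) ∧ ∀ j, g j (a j) = b j := by
  choose g hg hgx using fun j => (H j).exists_perm (by have := hk j; omega) (a j) (b j)
  have sum : ∀ z : HProd h, ∑ j, h j (g j (z.1 j)) = 0 := by
    intro z
    have : ∑ j, (h j (g j (z.1 j)) - h j (z.1 j)) = ∑ j, (h j (b j) - h j (a j)) :=
      Finset.sum_congr rfl fun j _ => by
        rw [(H j).shift_eq (H j) (hg j) (z.1 j) (a j), hgx]
    rw [Finset.sum_sub_distrib, Finset.sum_sub_distrib, z.2] at this
    omega
  have sum' : ∀ z : HProd h, ∑ j, h j ((g j).symm (z.1 j)) = 0 := by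
    intro z
    have : ∑ j, (h j (z.1 j) - h j ((g j).symm (z.1 j))) = ∑ j, (h j (b j) - h j (a j)) :=
      Finset.sum_congr rfl fun j _ => by
        have := (H j).shift_eq (H j) (hg j) ((g j).symm (z.1 j)) (a j)
        rwa [hgx, Equiv.apply_symm_apply] at this
    rw [Finset.sum_sub_distrib, Finset.sum_sub_distrib, z.2] at this
    omega
  obtain ⟨φ, h1, h2⟩ := exists_prod_aut hG g hg sum sum'
  exact ⟨φ, h1, fun j => g j, h2, hg, hgx⟩

theorem exists_aut (x y : HProd h) : ∃ φ : G ≃g G, Twist p φ 1 ∧ φ x = y := by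
  obtain ⟨φ, h1, g, h2, -, h3⟩ := exists_aut_of_sum_eq hG H hk x.1 y.1 (x.2.trans y.2.symm)
  exact ⟨φ, h1, Subtype.ext <| funext fun j => by rw [h2, h3]⟩

end Product

/-! ### The automorphism group of a locally finite graph -/

section Topology

open Filter Topology

variable {V : Type*} {G : SimpleGraph V}

theorem isOpen_apply_eq (x y : V) : IsOpen {g : G ≃g G | g x = y} := by
  let _ : TopologicalSpace V := ⊥
  have : DiscreteTopology V := ⟨rfl⟩
  have hc : Continuous fun g : G ≃g G => (g : V → V) := continuous_induced_dom
  exact (isOpen_discrete {y}).preimage ((continuous_apply x).comp hc)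

theorem continuous_aut {A : Type*} [TopologicalSpace A] {f : A → G ≃g G}
    (hf : ∀ x y, IsOpen {a | f a x = y}) : Continuous f := by
  let _ : TopologicalSpace V := ⊥
  have : DiscreteTopology V := ⟨rfl⟩
  refine continuous_induced_rng.2 (continuous_pi fun x => ?_)
  exact continuous_discrete_rng.2 fun y => hf x y

theorem tendsto_aut {A : Type*} {l : Filter A} {f : A → G ≃g G} {g : G ≃g G}
    (hf : ∀ x, ∀ᶠ a in l, f a x = g x) : Tendsto f l (𝓝 g) := by
  let _ : TopologicalSpace V := ⊥
  have : DiscreteTopology V := ⟨rfl⟩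
  rw [nhds_induced, tendsto_comap_iff, tendsto_pi_nhds]
  intro x
  rw [nhds_discrete, tendsto_pure]
  exact hf x

theorem isTopologicalGroup_aut : IsTopologicalGroup (G ≃g G) where
  continuous_mul := by
    refine continuous_aut fun x y => ?_
    have : {a : (G ≃g G) × (G ≃g G) | (a.1 * a.2) x = y} =
        ⋃ z, {g : G ≃g G | g z = y} ×ˢ {g : G ≃g G | g x = z} := by
      ext ⟨a, b⟩
      simp
    rw [this]
    exact isOpen_iUnion fun z => (isOpen_apply_eq z y).prod (isOpen_apply_eq x z)
  continuous_inv := by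
    refine continuous_aut fun x y => ?_
    have : {g : G ≃g G | g⁻¹ x = y} = {g | g y = x} := by
      ext g
      exact ⟨fun h => by rw [← show g⁻¹ x = y from h]; exact g.apply_symm_apply x,
        fun h => by rw [← show g y = x from h]; exact g.symm_apply_apply y⟩
    rw [this]
    exact isOpen_apply_eq y x

theorem finite_orbit (hc : G.Preconnected) (hf : ∀ x, (G.neighborSet x).Finite) (x y : V) :
    ((fun g : G ≃g G => g y) '' {g | g x = x}).Finite := by
  obtain ⟨w⟩ := hc y x
  induction w with
  | @nil u =>
    refine (Set.finite_singleton u).subset ?_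
    rintro _ ⟨g, hg, rfl⟩
    exact hg
  | @cons u v w ha _ ih =>
    refine (ih.biUnion fun z _ => hf z).subset ?_
    rintro _ ⟨g, hg, rfl⟩
    exact Set.mem_biUnion ⟨g, hg, rfl⟩ (g.map_adj_iff.2 ha.symm)

/-- Vertex stabilizers of a connected locally finite graph are compact. -/
theorem isCompact_stabilizer (hc : G.Preconnected) (hf : ∀ x, (G.neighborSet x).Finite) (x : V) :
    IsCompact {g : G ≃g G | g x = x} := by
  rw [isCompact_iff_ultrafilter_le_nhds]
  intro U hU
  rw [le_principal_iff] at hU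
  have h1 : ∀ y, ∃ z, ∀ᶠ g in (U : Filter (G ≃g G)), g y = z := by
    intro y
    obtain ⟨z, -, hz⟩ := Ultrafilter.eq_pure_of_finite_mem (f := U.map fun g : G ≃g G => g y)
      (finite_orbit hc hf x y) (by
        rw [Ultrafilter.mem_map]
        exact mem_of_superset hU (Set.subset_preimage_image _ _))
    refine ⟨z, ?_⟩
    have : ({z} : Set V) ∈ U.map fun g : G ≃g G => g y := by
      rw [hz]; exact Set.mem_singleton z
    exact this
  -- A pointwise limit of bijections need not be onto; the inverses also stay in finite orbits, and
  -- their limit inverts that of the maps.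
  have h2 : ∀ y, ∃ z, ∀ᶠ g in (U : Filter (G ≃g G)), g z = y := by
    intro y
    have hinv : {g : G ≃g G | g⁻¹ x = x} ∈ U := by
      refine mem_of_superset hU fun g hg => ?_
      have : g⁻¹ (g x) = x := g.symm_apply_apply x
      rwa [show g x = x from hg] at this
    obtain ⟨z, -, hz⟩ := Ultrafilter.eq_pure_of_finite_mem (f := U.map fun g : G ≃g G => g⁻¹ y)
      (finite_orbit hc hf x y) (by
        rw [Ultrafilter.mem_map]
        exact mem_of_superset hinv fun g hg => ⟨g⁻¹, hg, rfl⟩)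
    refine ⟨z, ?_⟩
    have : ({z} : Set V) ∈ U.map fun g : G ≃g G => g⁻¹ y := by
      rw [hz]; exact Set.mem_singleton z
    refine mem_of_superset this fun g hg => ?_
    change g z = y
    rw [← show g⁻¹ y = z from hg]
    exact g.apply_symm_apply y
  choose f hf' using h1
  choose f' hf'' using h2
  let e : V ≃ V :=
    { toFun := f
      invFun := f'
      left_inv := fun y => by
        obtain ⟨g, h1, h2⟩ := ((hf' y).and (hf'' (f y))).exists
        exact g.injective (h2.trans h1.symm)
      right_inv := fun y => by
        obtain ⟨g, h1, h2⟩ := ((hf' (f' y)).and (hf'' y)).exists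
        exact h1.symm.trans h2 }
  let φ : G ≃g G := ⟨e, fun {a b} => by
    obtain ⟨g, h1, h2⟩ := ((hf' a).and (hf' b)).exists
    change G.Adj (f a) (f b) ↔ G.Adj a b
    rw [← h1, ← h2]
    exact g.map_adj_iff⟩
  refine ⟨φ, ?_, tendsto_aut (f := id) hf'⟩
  obtain ⟨g, h1, h2⟩ := ((hf' x).and hU).exists
  exact h1.symm.trans h2

theorem locallyCompactSpace_aut (hc : G.Preconnected) (hf : ∀ x, (G.neighborSet x).Finite)
    [Nonempty V] : LocallyCompactSpace (G ≃g G) := by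
  have := isTopologicalGroup_aut (G := G)
  obtain ⟨x⟩ := ‹Nonempty V›
  exact (isCompact_stabilizer hc hf x).locallyCompactSpace_of_mem_nhds_of_group
    ((isOpen_apply_eq x x).mem_nhds (show (1 : G ≃g G) x = x from rfl))

end Topology

section Product

variable {d : ℕ} {W : Fin d → Type*} {p : ∀ j, W j → W j} {h : ∀ j, W j → ℤ} {k : Fin d → ℕ}
  {G : SimpleGraph (HProd h)} (hG : ∀ x y, G.Adj x y ↔ ∃ i j, Up p i j x y)
  (H : ∀ j, IsHoroTree (p j) (h j) (k j)) (hk : ∀ j, 2 ≤ k j)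
include hG H hk

theorem hprod_neighborSet_finite (x : HProd h) : (G.neighborSet x).Finite := by
  have hfin : {y : ∀ j, W j | ∀ j, y j ∈ insert (p j (x.1 j)) (insert (x.1 j)
      {w | p j w = x.1 j})}.Finite :=
    Set.Finite.pi' fun j => (((H j).finite_children (by have := hk j; omega) _).insert _).insert _
  refine (hfin.preimage Subtype.val_injective.injOn).subset fun y hy => ?_
  obtain ⟨i, j, u⟩ := (hG _ _).1 hy
  intro l
  by_cases h1 : l = i
  · subst h1; exact Or.inl u.2.1
  by_cases h2 : l = j
  · subst h2; exact Or.inr (Or.inr u.2.2.1)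
  · exact Or.inr (Or.inl (u.2.2.2 l h1 h2))

end Product

/-! ### Ultralimits and averages over boxes -/

section Means

open Filter Topology

/-- The limit along a fixed free ultrafilter. -/
noncomputable def ulim (f : ℕ → ℝ≥0∞) : ℝ≥0∞ := ((hyperfilter ℕ).map f).lim

theorem tendsto_ulim (f : ℕ → ℝ≥0∞) : Tendsto f (hyperfilter ℕ) (𝓝 (ulim f)) :=
  ((hyperfilter ℕ).map f).le_nhds_lim

theorem ulim_congr {f g : ℕ → ℝ≥0∞} (h : ∀ᶠ n in atTop, f n = g n) : ulim f = ulim g :=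
  tendsto_nhds_unique ((tendsto_ulim f).congr' (Nat.hyperfilter_le_atTop h)) (tendsto_ulim g)

theorem ulim_add (f g : ℕ → ℝ≥0∞) : ulim (fun n => f n + g n) = ulim f + ulim g :=
  tendsto_nhds_unique (tendsto_ulim _) ((tendsto_ulim f).add (tendsto_ulim g))

theorem ulim_of_tendsto {f : ℕ → ℝ≥0∞} {a : ℝ≥0∞} (h : Tendsto f atTop (𝓝 a)) : ulim f = a :=
  tendsto_nhds_unique (tendsto_ulim f) (h.mono_left Nat.hyperfilter_le_atTop)

theorem ulim_const (a : ℝ≥0∞) : ulim (fun _ => a) = a := ulim_of_tendsto tendsto_const_nhds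

theorem ulim_mono {f g : ℕ → ℝ≥0∞} (h : ∀ᶠ n in atTop, f n ≤ g n) : ulim f ≤ ulim g :=
  le_of_tendsto_of_tendsto (tendsto_ulim f) (tendsto_ulim g) (Nat.hyperfilter_le_atTop h)

/-- The average of a function over a finite set. -/
noncomputable def avg {X : Type*} (D : Finset X) (f : X → ℝ≥0∞) : ℝ≥0∞ :=
  (∑ x ∈ D, f x) / D.card

theorem avg_add {X : Type*} (D : Finset X) (f g : X → ℝ≥0∞) :
    avg D (fun x => f x + g x) = avg D f + avg D g := by
  unfold avg
  rw [Finset.sum_add_distrib, ENNReal.add_div]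

theorem avg_one {X : Type*} {D : Finset X} (hD : D.Nonempty) : avg D (fun _ => 1) = 1 := by
  unfold avg
  rw [Finset.sum_const, nsmul_eq_mul, mul_one]
  exact ENNReal.div_self (by simpa using hD.ne_empty) (ENNReal.natCast_ne_top _)

theorem avg_le_one {X : Type*} (D : Finset X) {f : X → ℝ≥0∞} (hf : ∀ x, f x ≤ 1) :
    avg D f ≤ 1 := by
  unfold avg
  refine ENNReal.div_le_of_le_mul ?_
  rw [one_mul]
  calc ∑ x ∈ D, f x ≤ ∑ x ∈ D, 1 := Finset.sum_le_sum fun x _ => hf x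
    _ = D.card := by simp

theorem avg_equiv {X Y : Type*} (e : X ≃ Y) {D : Finset X} {D' : Finset Y}
    (hD : ∀ x, x ∈ D ↔ e x ∈ D') (f : Y → ℝ≥0∞) : avg D (fun x => f (e x)) = avg D' f := by
  unfold avg
  rw [Finset.sum_equiv e hD fun _ _ => rfl, Finset.card_equiv e hD]

section Box

variable {ι : Type*} [Fintype ι] [DecidableEq ι]

/-- The box of side `R` in `ℤ^ι`. -/
noncomputable def box (ι : Type*) [Fintype ι] [DecidableEq ι] (R : ℕ) : Finset (ι → ℤ) :=
  Fintype.piFinset fun _ => Finset.Ico (0 : ℤ) R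

theorem mem_box {R : ℕ} {t : ι → ℤ} : t ∈ box ι R ↔ ∀ i, 0 ≤ t i ∧ t i < R := by
  simp [box]

theorem card_box (R : ℕ) : (box ι R).card = R ^ Fintype.card ι := by
  simp [box]

/-- The box shrunk by `K` on every side stays inside the box when translated by `ε`, and the share
cut off tends to zero. -/
theorem avg_box_shift_le (F : (ι → ℤ) → ℝ≥0∞) (hF : ∀ t, F t ≤ 1) (ε : ι → ℤ) :
    ulim (fun R => avg (box ι R) fun t => F (t + ε)) ≤ ulim (fun R => avg (box ι R) F) := by
  obtain ⟨K, hK⟩ : ∃ K : ℕ, ∀ i, |ε i| ≤ K := by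
    refine ⟨∑ i, (ε i).natAbs, fun i => ?_⟩
    rw [Int.abs_eq_natAbs]
    exact_mod_cast Finset.single_le_sum (f := fun i => (ε i).natAbs) (fun _ _ => Nat.zero_le _)
      (Finset.mem_univ i)
  set m := Fintype.card ι
  have hlim : Tendsto (fun R : ℕ => ENNReal.ofReal (1 - (1 - 2 * K / (R : ℝ)) ^ m)) atTop
      (𝓝 0) := by
    have h1 : Tendsto (fun R : ℕ => 2 * (K : ℝ) / (R : ℝ)) atTop (𝓝 0) :=
      tendsto_const_div_atTop_nhds_zero_nat _
    have h2 : Tendsto (fun R : ℕ => 1 - (1 - 2 * K / (R : ℝ)) ^ m) atTop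
        (𝓝 (1 - (1 - 0) ^ m)) :=
      tendsto_const_nhds.sub ((tendsto_const_nhds.sub h1).pow m)
    have h3 := ENNReal.tendsto_ofReal h2
    simpa using h3
  rw [← add_zero (ulim fun R => avg (box ι R) F), ← ulim_of_tendsto hlim, ← ulim_add]
  refine ulim_mono ?_
  filter_upwards [eventually_ge_atTop (2 * K + 1)] with R hR
  let inner : Finset (ι → ℤ) := Fintype.piFinset fun _ => Finset.Ico (K : ℤ) (R - K)
  have hsub : inner ⊆ box ι R := by
    intro t ht
    simp only [inner, Fintype.mem_piFinset, Finset.mem_Ico] at ht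
    rw [mem_box]
    intro i
    have := ht i
    omega
  have hcard : inner.card = (R - 2 * K) ^ m := by
    simp only [inner, Fintype.card_piFinset, Int.card_Ico, Finset.prod_const, Finset.card_univ]
    congr 1
    omega
  have h1 : ∑ t ∈ inner, F (t + ε) ≤ ∑ t ∈ box ι R, F t := by
    have e := Finset.sum_map inner (addRightEmbedding ε) F
    simp only [addRightEmbedding_apply] at e
    rw [← e]
    refine Finset.sum_le_sum_of_subset fun t ht => ?_
    obtain ⟨s, hs, rfl⟩ := Finset.mem_map.1 ht
    simp only [inner, Fintype.mem_piFinset, Finset.mem_Ico] at hs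
    rw [mem_box]
    intro i
    have h1 := hs i
    have h2 := abs_le.1 (hK i)
    change 0 ≤ s i + ε i ∧ s i + ε i < R
    omega
  have h2 : ∑ t ∈ box ι R \ inner, F (t + ε) ≤ ((R ^ m - (R - 2 * K) ^ m : ℕ) : ℝ≥0∞) := by
    calc ∑ t ∈ box ι R \ inner, F (t + ε) ≤ ∑ t ∈ box ι R \ inner, 1 :=
          Finset.sum_le_sum fun t _ => hF _
      _ = ((box ι R \ inner).card : ℝ≥0∞) := by simp
      _ = _ := by rw [Finset.card_sdiff_of_subset hsub, card_box, hcard]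
  have h3 : ((R ^ m - (R - 2 * K) ^ m : ℕ) : ℝ≥0∞) / ((R ^ m : ℕ) : ℝ≥0∞) =
      ENNReal.ofReal (1 - (1 - 2 * K / (R : ℝ)) ^ m) := by
    have hR0 : (0 : ℝ) < R := by exact_mod_cast (by omega : 0 < R)
    have hle : (R - 2 * K) ^ m ≤ R ^ m := Nat.pow_le_pow_left (Nat.sub_le _ _) m
    rw [← ENNReal.ofReal_natCast, ← ENNReal.ofReal_natCast (R ^ m),
      ← ENNReal.ofReal_div_of_pos (by exact_mod_cast pow_pos (by omega : 0 < R) m)]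
    congr 1
    rw [Nat.cast_sub hle]
    push_cast [Nat.cast_sub (by omega : 2 * K ≤ R)]
    rw [sub_div, div_self (pow_ne_zero _ hR0.ne'), ← div_pow, sub_div, div_self hR0.ne']
  unfold avg
  rw [card_box, ← h3, ← ENNReal.add_div, ← Finset.sum_sdiff hsub]
  refine ENNReal.div_le_div_right ?_ _
  rw [add_comm]
  exact add_le_add h1 h2

theorem avg_box_shift (F : (ι → ℤ) → ℝ≥0∞) (hF : ∀ t, F t ≤ 1) (ε : ι → ℤ) :
    ulim (fun R => avg (box ι R) fun t => F (t + ε)) = ulim (fun R => avg (box ι R) F) := by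
  refine le_antisymm (avg_box_shift_le F hF ε) ?_
  have := avg_box_shift_le (fun t => F (t + ε)) (fun t => hF _) (-ε)
  simpa [add_assoc] using this

end Box

end Means

/-! ### From a mean on the vertices to amenability -/

section Amenable

variable {V : Type*} {G : SimpleGraph V}

/-- An invariant mean on the vertex set yields amenability of the automorphism group. -/
theorem isAmenableGroup_of_mean (x₀ : V) (hK : IsCompact {g : G ≃g G | g x₀ = x₀})
    (htrans : ∀ x, ∃ g : G ≃g G, g x₀ = x) (M : (V → ℝ≥0∞) → ℝ≥0∞) (h1 : M (fun _ => 1) = 1)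
    (hadd : ∀ f f', M (fun x => f x + f' x) = M f + M f')
    (hinv : ∀ (g : G ≃g G) f, (∀ x, f x ≤ 1) → M (fun x => f (g x)) = M f) :
    IsAmenableGroup (G ≃g G) := by
  unfold IsAmenableGroup
  let _ : MeasurableSpace (G ≃g G) := borel _
  have : BorelSpace (G ≃g G) := ⟨rfl⟩
  have : IsTopologicalGroup (G ≃g G) := isTopologicalGroup_aut
  let K : TopologicalSpace.PositiveCompacts (G ≃g G) := ⟨⟨{g : G ≃g G | g x₀ = x₀}, hK⟩, by
    change (interior {g : G ≃g G | g x₀ = x₀}).Nonempty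
    rw [(isOpen_apply_eq x₀ x₀).interior_eq]
    exact ⟨1, rfl⟩⟩
  have : LocallyCompactSpace (G ≃g G) := K.locallyCompactSpace_of_group
  let ν : Measure (G ≃g G) := Measure.haarMeasure K
  have hνK : ν {g | g x₀ = x₀} = 1 := Measure.haarMeasure_self (K₀ := K)
  have hcoset : ∀ x, ν {g | g x₀ = x} = 1 := by
    intro x
    obtain ⟨g, hg⟩ := htrans x
    rw [← hνK, ← measure_preimage_mul ν g {h | h x₀ = x}]
    congr 1
    ext h
    change g (h x₀) = x ↔ h x₀ = x₀
    rw [← hg, g.injective.eq_iff]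
  have hmeas : ∀ x, MeasurableSet {g : G ≃g G | g x₀ = x} := fun x =>
    (isOpen_apply_eq x₀ x).measurableSet
  -- The cosets of the stabilizer of `x₀` are indexed by the image of `x₀` and have `ν`-mass one;
  -- `M` averages the share of `A` in them.
  refine ⟨fun A => M fun x => ν (A ∩ {g | g x₀ = x}), ?_, ?_, ?_, ?_⟩
  · simp only [Set.univ_inter, hcoset]
    exact h1
  · intro A B _ hB hAB
    beta_reduce
    rw [← hadd]
    congr 1
    funext x
    rw [Set.union_inter_distrib_right,
      measure_union (hAB.mono Set.inter_subset_left Set.inter_subset_left) (hB.inter (hmeas x))]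
  · intro g A _
    beta_reduce
    rw [← hinv g (fun x => ν (A ∩ {h | h x₀ = x}))
      (fun x => (measure_mono Set.inter_subset_right).trans_eq (hcoset x))]
    congr 1
    funext x
    rw [← measure_preimage_mul ν g (A ∩ {h | h x₀ = g x}), Set.preimage_inter]
    congr 2
    ext h
    change h x₀ = x ↔ g (h x₀) = g x
    rw [g.injective.eq_iff]
  · intro μ hμ hμr A _ hA
    have hνA : ν A = 0 := by
      rw [Measure.isMulLeftInvariant_eq_smul_of_regular ν μ, Measure.smul_apply, hA, smul_zero]
    have h0 : M (fun _ => 0) = 0 := by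
      have := hadd (fun _ => 1) (fun _ => 0)
      simp only [add_zero, h1] at this
      have h2 : (1 : ℝ≥0∞) + 0 = 1 + M (fun _ => 0) := by rw [add_zero]; exact this
      exact ((ENNReal.add_right_inj ENNReal.one_ne_top).1 h2).symm
    beta_reduce
    rw [← h0]
    congr 1
    funext x
    exact measure_mono_null Set.inter_subset_left hνA

end Amenable

/-! ### An invariant mean on the vertices of the product -/

namespace IsHoroTree

variable {W : Type*} {p : W → W} {h : W → ℤ} {k : ℕ} (H : IsHoroTree p h k)
include H

theorem finite_descendants (hk : 1 ≤ k) (n : ℕ) (v : W) : {w | p^[n] w = v}.Finite := by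
  induction n generalizing v with
  | zero => exact (Set.finite_singleton v).subset fun w hw => hw
  | succ n ih =>
    refine ((ih v).biUnion fun u _ => H.finite_children hk u).subset fun w hw => ?_
    refine Set.mem_biUnion (x := p w) ?_ rfl
    exact (Function.iterate_succ_apply p n w).symm.trans hw

theorem finite_block (hk : 1 ≤ k) (o : W) (c : ℤ) (n : ℕ) :
    {w | h w = c ∧ ∃ m, p^[n] w = p^[m] o}.Finite := by
  refine (H.finite_descendants hk n (p^[(h o - c + n).toNat] o)).subset ?_
  rintro w ⟨rfl, m, hm⟩
  have := congrArg h hm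
  rw [H.height_iterate, H.height_iterate] at this
  change p^[n] w = _
  rw [hm]
  congr 1
  omega

theorem map_iterate {W' : Type*} {p' : W' → W'} {g : W → W'} (hg : ∀ v, g (p v) = p' (g v))
    (n : ℕ) (v : W) : g (p^[n] v) = p'^[n] (g v) := by
  have _ := H
  induction n generalizing v with
  | zero => rfl
  | succ n ih => rw [Function.iterate_succ_apply, ih, hg]; rfl

/-- Maps commuting with the parent maps preserve membership in large blocks. -/
theorem exists_block_iff {W' : Type*} {p' : W' → W'} {h' : W' → ℤ} {k' : ℕ}
    (H' : IsHoroTree p' h' k') {g : W → W'} (hg : ∀ v, g (p v) = p' (g v))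
    (ginj : Function.Injective g) (o : W) (o' : W') (c : ℤ) :
    ∃ N : ℕ, ∀ n, N ≤ n → ∀ w, h w = c →
      ((∃ m, p^[n] w = p^[m] o) ↔ ∃ m, p'^[n] (g w) = p'^[m] o') := by
  obtain ⟨a, b, hab⟩ := H'.exists_common (g o) o'
  have he := congrArg h' hab
  rw [H'.height_iterate, H'.height_iterate] at he
  -- Height `c` forces `m = n - c + h o` for the ancestor of `o` in question, so this bound gives `a
  -- ≤ m`: from there on the image of the ray of `o` has merged with the ray of `o'`.
  refine ⟨a + (c - h o).toNat, fun n hn w hw => ⟨?_, ?_⟩⟩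
  · rintro ⟨m, hm⟩
    have e := congrArg h hm
    rw [H.height_iterate, H.height_iterate] at e
    obtain ⟨l, rfl⟩ : ∃ l, m = l + a := Nat.exists_eq_add_of_le' (by omega)
    refine ⟨l + b, ?_⟩
    rw [← H.map_iterate hg, hm, H.map_iterate hg, Function.iterate_add_apply, hab,
      ← Function.iterate_add_apply]
  · rintro ⟨m, hm⟩
    have e := congrArg h' hm
    rw [H'.height_iterate, H'.height_iterate] at e
    have s := H.shift_eq H' hg w o
    obtain ⟨l, rfl⟩ : ∃ l, m = l + b := Nat.exists_eq_add_of_le' (by omega)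
    refine ⟨l + a, ginj ?_⟩
    rw [H.map_iterate hg, hm, H.map_iterate hg, Function.iterate_add_apply, ← hab,
      ← Function.iterate_add_apply]

end IsHoroTree

section Product

variable {d : ℕ} {W : Fin d → Type*} {p : ∀ j, W j → W j} {h : ∀ j, W j → ℤ} {k : Fin d → ℕ}
  {G : SimpleGraph (HProd h)}

/-- The vertices whose `j`-th coordinate has height `c j` and a common `n`-th ancestor with the
vertices of the same height on the ray of `o j`. -/
def block (p : ∀ j, W j → W j) {h : ∀ j, W j → ℤ} (o : ∀ j, W j) (c : Fin d → ℤ) (n : ℕ) :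
    Set (HProd h) :=
  {x | ∀ j, h j (x.1 j) = c j ∧ ∃ m, (p j)^[n] (x.1 j) = (p j)^[m] (o j)}

section

variable (H : ∀ j, IsHoroTree (p j) (h j) (k j)) (hk : ∀ j, 2 ≤ k j)
include H hk

theorem block_finite (o : ∀ j, W j) (c : Fin d → ℤ) (n : ℕ) : (block p (h := h) o c n).Finite := by
  have hfin : {y : ∀ j, W j | ∀ j, y j ∈ {w | h j w = c j ∧
      ∃ m, (p j)^[n] w = (p j)^[m] (o j)}}.Finite :=
    Set.Finite.pi' fun j => (H j).finite_block (by have := hk j; omega) (o j) (c j) n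
  exact hfin.preimage Subtype.val_injective.injOn

theorem block_nonempty (o : ∀ j, W j) {c : Fin d → ℤ} (hc : ∑ j, c j = 0) :
    ∀ᶠ n in Filter.atTop, (block p (h := h) o c n).Nonempty := by
  choose w hw using fun j => (H j).exists_height (by have := hk j; omega) (c j)
  choose a b hab using fun j => (H j).exists_common (w j) (o j)
  filter_upwards [Filter.eventually_ge_atTop (∑ j, a j)] with n hn
  refine ⟨⟨w, by simp only [hw, hc]⟩, fun j => ⟨hw j, ?_⟩⟩
  have hle : a j ≤ n := (Finset.single_le_sum (f := a) (fun _ _ => Nat.zero_le _)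
    (Finset.mem_univ j)).trans hn
  obtain ⟨l, rfl⟩ := Nat.exists_eq_add_of_le' hle
  refine ⟨l + b j, ?_⟩
  change (p j)^[l + a j] (w j) = _
  rw [Function.iterate_add_apply, hab, ← Function.iterate_add_apply]

/-- The mean over the large blocks of type `c`. -/
theorem exists_block_mean (hd : 2 ≤ d) (hG : ∀ x y, G.Adj x y ↔ ∃ i j, Up p i j x y) :
    ∃ α : (Fin d → ℤ) → (HProd h → ℝ≥0∞) → ℝ≥0∞,
      (∀ c, ∑ j, c j = 0 → α c (fun _ => 1) = 1) ∧
      (∀ c f f', α c (fun x => f x + f' x) = α c f + α c f') ∧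
      (∀ c f, (∀ x, f x ≤ 1) → α c f ≤ 1) ∧
      ∀ φ : G ≃g G, ∃ (τ : Equiv.Perm (Fin d)) (e : Fin d → ℤ), ∑ j, e j = 0 ∧
        ∀ c f, α c (fun x => f (φ x)) = α (fun j => c (τ j) + e j) f := by
  have o : ∀ j, W j := fun j => (H j).nonempty.some
  have hmem : ∀ {c n x}, x ∈ (block_finite H hk o c n).toFinset ↔ x ∈ block p (h := h) o c n :=
    fun {c n x} => (block_finite H hk o c n).mem_toFinset
  refine ⟨fun c f => ulim fun n => avg (block_finite H hk o c n).toFinset f, ?_, ?_, ?_, ?_⟩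
  · intro c hc
    refine (ulim_congr ?_).trans (ulim_const 1)
    filter_upwards [block_nonempty H hk o hc] with n hn
    exact avg_one ((Set.Finite.toFinset_nonempty _).2 hn)
  · intro c f f'
    rw [← ulim_add]
    simp only [avg_add]
  · intro c f hf
    exact (ulim_mono (Filter.Eventually.of_forall fun n => avg_le_one _ hf)).trans_eq (ulim_const 1)
  · intro φ
    obtain ⟨τ, ht, -⟩ := exists_twist hG H hd hk φ
    choose g hg hgp ginj using ht.exists_coord_map hG H hd hk
    let e' : Fin d → ℤ := fun i => h (τ i) (g i (o i)) - h i (o i)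
    have he' : ∀ i v, h (τ i) (g i v) = h i v + e' i := fun i v => by
      have := (H i).shift_eq (H (τ i)) (hgp i) v (o i)
      change _ = _ + (h (τ i) (g i (o i)) - h i (o i))
      omega
    have hsum : ∑ i, e' i = 0 := by
      have : Nontrivial (Fin d) := Fin.nontrivial_iff_two_le.2 hd
      obtain ⟨i, -, -⟩ := exists_pair_ne (Fin d)
      obtain ⟨x, -⟩ := exists_coord H hd hk i (o i)
      have e1 : ∑ i, h (τ i) ((φ x).1 (τ i)) = 0 :=
        (Equiv.sum_comp τ fun j => h j ((φ x).1 j)).trans (φ x).2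
      simp only [hg, he'] at e1
      rw [Finset.sum_add_distrib, x.2, zero_add] at e1
      exact e1
    refine ⟨τ.symm, fun j => e' (τ.symm j), (Equiv.sum_comp τ.symm e').trans hsum,
      fun c f => ulim_congr ?_⟩
    choose N hN using fun i =>
      (H i).exists_block_iff (H (τ i)) (hgp i) (ginj i) (o i) (o (τ i)) (c i)
    filter_upwards [Filter.eventually_ge_atTop (∑ i, N i)] with n hn
    refine avg_equiv φ.toEquiv (fun x => ?_) f
    rw [hmem, hmem]
    have hle : ∀ i, N i ≤ n := fun i => (Finset.single_le_sum (f := N) (fun _ _ => Nat.zero_le _)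
      (Finset.mem_univ i)).trans hn
    change (∀ i, _) ↔ (∀ j, h j ((φ x).1 j) = c (τ.symm j) + e' (τ.symm j) ∧
      ∃ m, (p j)^[n] ((φ x).1 j) = (p j)^[m] (o j))
    refine Iff.trans ?_ τ.forall_congr_right
    refine forall_congr' fun i => ?_
    rw [hg, he', Equiv.symm_apply_apply, add_left_inj]
    exact and_congr_right fun hc => hN i n (hle i) _ hc

/-- Automorphisms move the means `α c` by permuting and translating height vectors with sum zero, so
it remains to average over these vectors invariantly. -/
theorem exists_invariant_mean (hd : 2 ≤ d) (hG : ∀ x y, G.Adj x y ↔ ∃ i j, Up p i j x y) :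
    ∃ M : (HProd h → ℝ≥0∞) → ℝ≥0∞, M (fun _ => 1) = 1 ∧
      (∀ f f', M (fun x => f x + f' x) = M f + M f') ∧
      ∀ (φ : G ≃g G) f, (∀ x, f x ≤ 1) → M (fun x => f (φ x)) = M f := by
  obtain ⟨α, α1, α2, α3, α4⟩ := exists_block_mean H hk hd hG
  -- This additive map onto the vectors with sum zero commutes with permutations of the indices, and
  -- the boxes in its source are permutation invariant.
  let v : (Fin d × Fin d → ℤ) → Fin d → ℤ := fun t j => ∑ l, t (j, l) - ∑ l, t (l, j)
  have hv : ∀ t, ∑ j, v t j = 0 := fun t => by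
    change ∑ j, (∑ l, t (j, l) - ∑ l, t (l, j)) = 0
    rw [Finset.sum_sub_distrib, Finset.sum_comm, sub_self]
  refine ⟨fun f => ulim fun R => avg (box (Fin d × Fin d) R) fun t => α (v t) f, ?_, ?_, ?_⟩
  · simp only [α1 _ (hv _)]
    refine (ulim_congr ?_).trans (ulim_const 1)
    filter_upwards [Filter.eventually_ge_atTop 1] with R hR
    exact avg_one ⟨0, mem_box.2 fun i => ⟨le_rfl, Nat.cast_pos.2 hR⟩⟩
  · intro f f'
    rw [← ulim_add]
    simp only [← avg_add, α2]
  · intro φ f hf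
    obtain ⟨τ, e, he, hτ⟩ := α4 φ
    obtain ⟨ε, hε⟩ : ∃ ε, v ε = e := by
      let z : Fin d := ⟨0, by omega⟩
      -- The entries of `e` fill column `z`; the column sum that is subtracted vanishes with the sum
      -- of `e`.
      refine ⟨fun a => if a.2 = z then e a.1 else 0, funext fun j => ?_⟩
      change ∑ l, (if l = z then e j else 0) - ∑ l, (if j = z then e l else 0) = e j
      rw [Finset.sum_ite_eq' Finset.univ z, if_pos (Finset.mem_univ z)]
      by_cases hj : j = z
      · simp [hj, he]
      · simp [hj]
    beta_reduce
    rw [← avg_box_shift (fun t => α (v t) f) (fun t => α3 _ f hf) ε]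
    congr 1
    funext R
    let σ : Equiv.Perm (Fin d × Fin d) := Equiv.prodCongr τ τ
    let E : (Fin d × Fin d → ℤ) ≃ (Fin d × Fin d → ℤ) := Equiv.arrowCongr σ.symm (Equiv.refl ℤ)
    have hE : ∀ t a, E t a = t (σ a) := fun t a => rfl
    rw [← avg_equiv E (D := box _ R) (D' := box _ R) (fun t => ?_) (fun t => α (v (t + ε)) f)]
    · congr 1
      funext t
      rw [hτ]
      congr 1
      funext j
      have h1 : v t (τ j) = v (E t) j := by
        change ∑ l, t (τ j, l) - ∑ l, t (l, τ j) = ∑ l, t (τ j, τ l) - ∑ l, t (τ l, τ j)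
        rw [Equiv.sum_comp τ fun l => t (τ j, l), Equiv.sum_comp τ fun l => t (l, τ j)]
      rw [h1, ← hε]
      change _ = ∑ l, (E t (j, l) + ε (j, l)) - ∑ l, (E t (l, j) + ε (l, j))
      rw [Finset.sum_add_distrib, Finset.sum_add_distrib]
      change (∑ l, E t (j, l) - ∑ l, E t (l, j)) + (∑ l, ε (j, l) - ∑ l, ε (l, j)) = _
      ring
    · rw [mem_box, mem_box]
      simp only [hE]
      exact (σ.forall_congr_right (q := fun a => 0 ≤ t a ∧ t a < R)).symm

theorem isAmenableGroup_hprod (hd : 2 ≤ d) (hG : ∀ x y, G.Adj x y ↔ ∃ i j, Up p i j x y) :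
    IsAmenableGroup (G ≃g G) := by
  obtain ⟨M, h1, h2, h3⟩ := exists_invariant_mean H hk hd hG
  obtain ⟨x, -⟩ := exists_coord H hd hk ⟨0, by omega⟩ (H _).nonempty.some
  refine isAmenableGroup_of_mean x (isCompact_stabilizer (hprod_preconnected hG H hd hk)
    (hprod_neighborSet_finite hG H hk) x) (fun y => ?_) M h1 h2 h3
  obtain ⟨φ, -, hφ⟩ := exists_aut hG H hk x y
  exact ⟨φ, hφ⟩

end

end Product

/-! ### Haar measure of stabilizers and unimodularity -/

section Product

variable {d : ℕ} {W : Fin d → Type*} {p : ∀ j, W j → W j} {h : ∀ j, W j → ℤ} {k : Fin d → ℕ}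
  {G : SimpleGraph (HProd h)}

/-- The automorphisms which fix the vertex `x` and do not permute the coordinates. -/
def pureStab (p : ∀ j, W j → W j) (G : SimpleGraph (HProd h)) (x : HProd h) : Set (G ≃g G) :=
  {φ | Twist p φ 1 ∧ φ x = x}

section

variable (hG : ∀ x y, G.Adj x y ↔ ∃ i j, Up p i j x y) (H : ∀ j, IsHoroTree (p j) (h j) (k j))
  (hd : 2 ≤ d) (hk : ∀ j, 2 ≤ k j)
include hG H hd hk

theorem exists_subgroup_twist_one :
    ∃ S : Subgroup (G ≃g G), (S : Set (G ≃g G)) = {φ | Twist p φ 1} :=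
  ⟨{ carrier := {φ | Twist p φ 1}
     mul_mem' := fun {φ ψ} h1 h2 => by
        have := Twist.mul h1 h2
        rwa [mul_one] at this
     one_mem' := Twist.one
     inv_mem' := fun {φ} h1 => by
        have := Twist.inv hG H hd hk h1
        rwa [inv_one] at this }, rfl⟩

/-- An automorphism which fixes a vertex and one sibling of it in each coordinate cannot permute the
coordinates. -/
theorem isOpen_twist_one : IsOpen {φ : G ≃g G | Twist p φ 1} := by
  have := isTopologicalGroup_aut (G := G)
  obtain ⟨S, hS⟩ := exists_subgroup_twist_one hG H hd hk
  rw [← hS]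
  refine S.isOpen_of_mem_nhds (g := 1) ?_
  obtain ⟨x, -⟩ := exists_coord H hd hk ⟨0, by omega⟩ (H _).nonempty.some
  choose y hy using fun j => exists_sib H hk j x
  have ho : IsOpen ({φ : G ≃g G | φ x = x} ∩ ⋂ j, {φ : G ≃g G | φ (y j) = y j}) :=
    (isOpen_apply_eq x x).inter (isOpen_iInter_of_finite fun j => isOpen_apply_eq _ _)
  refine Filter.mem_of_superset (ho.mem_nhds ⟨rfl, Set.mem_iInter.2 fun j => rfl⟩) ?_
  rintro φ ⟨h1, h2⟩
  rw [Set.mem_iInter] at h2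
  obtain ⟨τ, ht, hs⟩ := exists_twist hG H hd hk φ
  have : τ = 1 := Equiv.ext fun j => by
    have e := hs j x (y j) (hy j)
    rw [show φ x = x from h1, show φ (y j) = y j from h2 j] at e
    by_contra hne
    exact e.1 ((hy j).2.2 _ hne).symm
  rw [hS]
  exact this ▸ ht

theorem isOpen_pureStab (x : HProd h) : IsOpen (pureStab p G x) :=
  (isOpen_twist_one hG H hd hk).inter (isOpen_apply_eq x x)

theorem isCompact_pureStab (x : HProd h) : IsCompact (pureStab p G x) := by
  have := isTopologicalGroup_aut (G := G)
  obtain ⟨S, hS⟩ := exists_subgroup_twist_one hG H hd hk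
  have hc : IsClosed (S : Set (G ≃g G)) := S.isClosed_of_isOpen (hS ▸ isOpen_twist_one hG H hd hk)
  rw [hS] at hc
  exact (isCompact_stabilizer (hprod_preconnected hG H hd hk)
    (hprod_neighborSet_finite hG H hk) x).inter_left hc

theorem conj_mem_pureStab (g φ : G ≃g G) (x : HProd h) :
    g * φ * g⁻¹ ∈ pureStab p G (g x) ↔ φ ∈ pureStab p G x := by
  have key : ∀ (g φ : G ≃g G), Twist p φ 1 → Twist p (g * φ * g⁻¹) 1 := by
    intro g φ h1
    obtain ⟨τ, ht, -⟩ := exists_twist hG H hd hk g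
    have := (ht.mul h1).mul (ht.inv hG H hd hk)
    rwa [mul_one, mul_inv_cancel] at this
  have e : (g * φ * g⁻¹) (g x) = g (φ x) := congrArg (fun z => g (φ z)) (g.symm_apply_apply x)
  refine and_congr ⟨fun h1 => ?_, key g φ⟩ ?_
  · have := key g⁻¹ _ h1
    rwa [inv_inv, mul_assoc, mul_assoc, mul_assoc, inv_mul_cancel, mul_one, inv_mul_cancel_left]
      at this
  · rw [e, g.injective.eq_iff]

/-- The measures of the stabilizers of neighbouring vertices. -/
theorem measure_pureStab_eq [MeasurableSpace (G ≃g G)] [BorelSpace (G ≃g G)]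
    (μ : Measure (G ≃g G)) [μ.IsMulLeftInvariant] {i j : Fin d} {x y : HProd h}
    (u : Up p i j x y) :
    μ (pureStab p G x) = k j * μ (pureStab p G x ∩ pureStab p G y) := by
  have := isTopologicalGroup_aut (G := G)
  have hkj := hk j
  have hp := fun j => (H j).height_parent
  let C : Set (W j) := {c | p j c = x.1 j}
  have hfin : C.Finite := (H j).finite_children (by omega) _
  have : Fintype C := hfin.fintype
  have hcard : Fintype.card C = k j := by
    rw [← (H j).ncard_children (x.1 j), Set.ncard_eq_toFinset_card', Set.toFinset_card]
  -- These are the cosets of the stabilizer of `y` in that of `x`, one for each child of `x.1 j`.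
  let P : C → Set (G ≃g G) := fun c => {φ | φ ∈ pureStab p G x ∧ (φ y).1 j = c.1}
  have hunion : pureStab p G x = ⋃ c, P c := by
    ext φ
    rw [Set.mem_iUnion]
    refine ⟨fun h1 => ⟨⟨(φ y).1 j, ?_⟩, h1, rfl⟩, fun ⟨_, h1, _⟩ => h1⟩
    have := (h1.1 i j x y u).2.2.1
    rwa [h1.2] at this
  have hdis : Pairwise (Function.onFun Disjoint P) := by
    intro c c' hcc
    refine Set.disjoint_left.2 fun φ h1 h2 => hcc (Subtype.ext (h1.2.symm.trans h2.2))
  have hy : ∀ φ : G ≃g G, φ ∈ pureStab p G x → (φ y).1 j = y.1 j → φ y = y := by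
    intro φ h1 h2
    have u' := h1.1 i j x y u
    rw [h1.2] at u'
    refine Subtype.ext <| funext fun l => ?_
    by_cases hl : l = j
    · subst hl; exact h2
    by_cases hl' : l = i
    · subst hl'; exact u'.2.1.trans u.2.1.symm
    · exact (u'.2.2.2 l hl' hl).trans (u.2.2.2 l hl' hl).symm
  have hone : ∀ φ ψ : G ≃g G, φ ∈ pureStab p G x → (ψ ∈ pureStab p G x ↔
      φ * ψ ∈ pureStab p G x) := by
    intro φ ψ h1
    constructor
    · rintro h2
      refine ⟨?_, ?_⟩
      · have := h1.1.mul h2.1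
        rwa [one_mul] at this
      · change φ (ψ x) = x
        rw [h2.2, h1.2]
    · rintro h2
      refine ⟨?_, ?_⟩
      · have := (h1.1.inv hG H hd hk).mul h2.1
        rwa [inv_one, one_mul, inv_mul_cancel_left] at this
      · have := h2.2
        change φ (ψ x) = x at this
        exact φ.injective (this.trans h1.2.symm)
  have hpiece : ∀ c, μ (P c) = μ (pureStab p G x ∩ pureStab p G y) := by
    intro c
    -- The two tuples are not vertices: putting a child of `x.1 j` into `x` makes both height sums
    -- one. The resulting `φ` fixes `x` and sends `y.1 j` to `c`.
    obtain ⟨φ, hφ, g, h1, h2, h3⟩ := exists_aut_of_sum_eq hG H hk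
      (Function.update x.1 j (y.1 j)) (Function.update x.1 j c.1) (by
        refine Finset.sum_congr rfl fun l _ => ?_
        by_cases hl : l = j
        · subst hl
          have e1 := hp l (y.1 l)
          have e2 := hp l c.1
          rw [u.2.2.1] at e1
          rw [show p l c.1 = x.1 l from c.2] at e2
          rw [Function.update_self, Function.update_self]
          omega
        · rw [Function.update_of_ne hl, Function.update_of_ne hl])
    have hφj : g j (y.1 j) = c.1 := by simpa using h3 j
    have hφx : φ x = x := by
      refine Subtype.ext <| funext fun l => ?_
      rw [h1]
      by_cases hl : l = j
      · subst hl
        rw [← u.2.2.1, h2, hφj, u.2.2.1]; exact c.2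
      · simpa [Function.update_of_ne hl] using h3 l
    have hmem : φ ∈ pureStab p G x := ⟨hφ, hφx⟩
    rw [← measure_preimage_mul μ φ (P c)]
    congr 1
    ext ψ
    change (φ * ψ ∈ pureStab p G x ∧ (φ (ψ y)).1 j = c.1) ↔ _
    have hgj : Function.Injective (g j) := by
      intro v w e
      obtain ⟨z, hz⟩ := exists_coord H hd hk j v
      obtain ⟨z', hz'⟩ := exists_coord H hd hk j w
      have := (hφ.inv hG H hd hk).coord_eq H hk j (φ z) (φ z') (by
        rw [h1, h1, hz, hz', e])
      have e1 : ∀ z : HProd h, φ⁻¹ (φ z) = z := φ.symm_apply_apply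
      rw [e1, e1, inv_one] at this
      rw [← hz, ← hz']
      exact this
    rw [← hone φ ψ hmem, h1, ← hφj, hgj.eq_iff]
    refine and_congr_right fun h1 => ⟨fun h2 => ?_, fun h2 => ?_⟩
    · have h3 := hy ψ h1 h2
      exact ⟨h1.1, h3⟩
    · rw [show ψ y = y from h2.2]
  have hmeas : ∀ c, MeasurableSet (P c) := by
    intro c
    have : P c = pureStab p G x ∩ ⋃ z ∈ {z : HProd h | z.1 j = c.1}, {φ | φ y = z} := by
      ext φ
      simp [P]
    rw [this]
    exact ((isOpen_pureStab hG H hd hk x).inter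
      (isOpen_biUnion fun z _ => isOpen_apply_eq y z)).measurableSet
  rw [hunion, measure_iUnion hdis hmeas, tsum_fintype]
  simp only [hpiece, Finset.sum_const, Finset.card_univ, hcard, nsmul_eq_mul]
  rw [← hunion]

theorem measure_pureStab_mul_eq [MeasurableSpace (G ≃g G)] [BorelSpace (G ≃g G)]
    (μ : Measure (G ≃g G)) [μ.IsMulLeftInvariant] {i j : Fin d} {x y : HProd h}
    (u : Up p i j x y) : k i * μ (pureStab p G x) = k j * μ (pureStab p G y) := by
  rw [measure_pureStab_eq hG H hd hk μ u, measure_pureStab_eq hG H hd hk μ u.symm,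
    Set.inter_comm (pureStab p G y), ← mul_assoc, ← mul_assoc, mul_comm (k i : ℝ≥0∞)]

theorem measure_pureStab_ne [MeasurableSpace (G ≃g G)] [BorelSpace (G ≃g G)]
    (μ : Measure (G ≃g G)) [μ.IsHaarMeasure] (x : HProd h) :
    μ (pureStab p G x) ≠ 0 ∧ μ (pureStab p G x) ≠ ⊤ :=
  ⟨((isOpen_pureStab hG H hd hk x).measure_pos μ ⟨1, Twist.one, rfl⟩).ne',
    (isCompact_pureStab hG H hd hk x).measure_lt_top.ne⟩

/-- The right translate of a stabilizer has the measure of a conjugate stabilizer. -/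
theorem measure_preimage_mul_right_pureStab [MeasurableSpace (G ≃g G)] [BorelSpace (G ≃g G)]
    (μ : Measure (G ≃g G)) [μ.IsMulLeftInvariant] (g : G ≃g G) (x : HProd h) :
    μ ((fun φ => φ * g) ⁻¹' pureStab p G x) = μ (pureStab p G (g x)) := by
  have := isTopologicalGroup_aut (G := G)
  rw [← measure_preimage_mul μ g⁻¹ ((fun φ => φ * g) ⁻¹' pureStab p G x)]
  congr 1
  ext φ
  change g⁻¹ * φ * g ∈ pureStab p G x ↔ _
  rw [← conj_mem_pureStab hG H hd hk g]
  congr! 1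
  group

/-- Right translation by `g` compares the stabilizers of `x` and `g x`. A right translate of Haar
measure is a multiple of it, so its value on one stabilizer decides whether they are equal. -/
theorem isUnimodularGroup_hprod : IsUnimodularGroup (G ≃g G) ↔ ∀ i j, k i = k j := by
  unfold IsUnimodularGroup
  let _ : MeasurableSpace (G ≃g G) := borel _
  have : BorelSpace (G ≃g G) := ⟨rfl⟩
  have : IsTopologicalGroup (G ≃g G) := isTopologicalGroup_aut
  obtain ⟨x, -⟩ := exists_coord H hd hk ⟨0, by omega⟩ (H _).nonempty.some
  have : Nonempty (HProd h) := ⟨x⟩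
  have : LocallyCompactSpace (G ≃g G) := locallyCompactSpace_aut
    (hprod_preconnected hG H hd hk) (hprod_neighborSet_finite hG H hk)
  constructor
  · rintro ⟨μ, hμ, -, hinv⟩ i j
    by_cases hij : i = j
    · rw [hij]
    obtain ⟨c, hc⟩ := (H j).exists_child (by have := hk j; omega) (x.1 j)
    obtain ⟨y, u, -⟩ := exists_up H hij x hc
    obtain ⟨g, -, hg⟩ := exists_aut hG H hk x y
    have e1 := measure_pureStab_mul_eq hG H hd hk μ u
    rw [← hg, ← measure_preimage_mul_right_pureStab hG H hd hk μ g x,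
      measure_preimage_mul_right] at e1
    obtain ⟨h0, h1⟩ := measure_pureStab_ne hG H hd hk μ x
    exact_mod_cast (ENNReal.mul_left_inj h0 h1).1 e1
  · intro hk'
    let μ : Measure (G ≃g G) := Measure.haar
    refine ⟨μ, inferInstance, inferInstance, ⟨fun g => ?_⟩⟩
    have const : ∀ x y, μ (pureStab p G x) = μ (pureStab p G y) := by
      intro x y
      obtain ⟨w⟩ := hprod_preconnected hG H hd hk x y
      induction w with
      | nil => rfl
      | cons ha _ ih =>
        obtain ⟨i, j, u⟩ := (hG _ _).1 ha
        have e1 := measure_pureStab_mul_eq hG H hd hk μ u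
        rw [hk' i j, ENNReal.mul_right_inj (by have := hk j; simp; omega)
          (ENNReal.natCast_ne_top _)] at e1
        rw [e1, ih]
    have hreg : (Measure.map (fun φ => φ * g) μ).Regular :=
      Measure.Regular.map (Homeomorph.mulRight g)
    have e1 := Measure.isMulLeftInvariant_eq_smul_of_regular (Measure.map (fun φ => φ * g) μ) μ
    have e2 : Measure.map (fun φ => φ * g) μ (pureStab p G x) = μ (pureStab p G x) := by
      rw [Measure.map_apply (measurable_mul_const g)
        (isOpen_pureStab hG H hd hk x).measurableSet,
        measure_preimage_mul_right_pureStab hG H hd hk μ g x, const]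
    rw [e1, Measure.smul_apply, ENNReal.smul_def, smul_eq_mul] at e2
    obtain ⟨h0, h1⟩ := measure_pureStab_ne hG H hd hk μ x
    have e3 := (ENNReal.mul_left_inj h0 h1).1 (e2.trans (one_mul _).symm)
    rw [e1, show Measure.haarScalarFactor (Measure.map (fun φ => φ * g) μ) μ = 1 by
      exact_mod_cast e3, one_smul]

end

end Product

/-! ### The semidirect product acting on the graph -/

section Casts

variable {d : ℕ} {q : Fin d → ℕ}

theorem cast_rel {F : ℕ → Type*} (R : ∀ n, F n → F n → Prop) {m n : ℕ} (e : m = n) (a b : F m) :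
    R n (cast (congrArg F e) a) (cast (congrArg F e) b) ↔ R m a b := by
  subst e; rfl

theorem permute_rel {F : ℕ → Type*} (R : ∀ n, F n → F n → Prop) (σ : permGroup q)
    (x y : ∀ j, F (q j)) (j : Fin d) :
    R (q j) (permute σ x j) (permute σ y j) ↔
      R (q ((σ : Equiv.Perm (Fin d))⁻¹ j)) (x ((σ : Equiv.Perm (Fin d))⁻¹ j))
        (y ((σ : Equiv.Perm (Fin d))⁻¹ j)) :=
  cast_rel R (permGroup_inv σ j) _ _

theorem permute_rel_apply {F : ℕ → Type*} (R : ∀ n, F n → F n → Prop) (σ : permGroup q)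
    (x y : ∀ j, F (q j)) (j : Fin d) :
    R _ (permute σ x ((σ : Equiv.Perm (Fin d)) j)) (permute σ y ((σ : Equiv.Perm (Fin d)) j)) ↔
      R (q j) (x j) (y j) := by
  rw [permute_rel R]
  rw [show (σ : Equiv.Perm (Fin d))⁻¹ ((σ : Equiv.Perm (Fin d)) j) = j from
    (σ : Equiv.Perm (Fin d)).symm_apply_apply j]

theorem cast_apply {F : ℕ → Type*} {S : ℕ → Type*} (ev : ∀ n, S n → F n → F n) {m n : ℕ}
    (e : m = n) (a : S m) (v : F m) :
    ev n (cast (congrArg S e) a) (cast (congrArg F e) v) = cast (congrArg F e) (ev m a v) := by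
  subst e; rfl

end Casts

universe u

section Homs

variable {d : ℕ} {q : Fin d → ℕ} {V : ℕ → Type u} {T : ∀ n, SimpleGraph (V n)}
  {ω : ∀ n, TreeEnd (T n)} {o : ∀ n, V n}

theorem sum_hor_permute (σ : permGroup q) (x : ∀ j, V (q j)) :
    ∑ j, hor (ω (q j)) (o (q j)) (permute σ x j) = ∑ j, hor (ω (q j)) (o (q j)) (x j) := by
  rw [← Equiv.sum_comp (σ : Equiv.Perm (Fin d))⁻¹ fun j => hor (ω (q j)) (o (q j)) (x j)]
  exact Finset.sum_congr rfl fun j _ =>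
    cast_map (fun n => hor (ω n) (o n)) (permGroup_inv σ j) _

theorem dl_adj_permute (σ : permGroup q) {x y x' y' : DLVertex q ω o}
    (hx : x'.1 = permute σ x.1) (hy : y'.1 = permute σ y.1) (h : (DL q ω o).Adj x y) :
    (DL q ω o).Adj x' y' := by
  obtain ⟨i, j, hij, hi, hj, hk⟩ := h
  refine ⟨(σ : Equiv.Perm (Fin d)) i, (σ : Equiv.Perm (Fin d)) j,
    (σ : Equiv.Perm (Fin d)).injective.ne hij, ?_, ?_, fun l hl hl' => ?_⟩
  · rw [hx, hy]
    exact (permute_rel_apply (fun n => (T n).Adj) σ x.1 y.1 i).2 hi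
  · rw [hx, hy]
    exact (permute_rel_apply (fun n => (T n).Adj) σ x.1 y.1 j).2 hj
  · obtain ⟨m, rfl⟩ := (σ : Equiv.Perm (Fin d)).surjective l
    rw [hx, hy]
    exact (permute_rel_apply (fun _ a b => a = b) σ x.1 y.1 m).2
      (hk m (fun e => hl (by rw [e])) (fun e => hl' (by rw [e])))

variable (q ω o)

/-- The action of the admissible permutations on the Diestel-Leader graph. -/
def permHom : permGroup q →* (DL q ω o ≃g DL q ω o) where
  toFun σ :=
    { toFun := fun x => ⟨permute σ x.1, (sum_hor_permute σ x.1).trans x.2⟩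
      invFun := fun x => ⟨permute σ⁻¹ x.1, (sum_hor_permute σ⁻¹ x.1).trans x.2⟩
      left_inv := fun x => Subtype.ext <| by
        change permute σ⁻¹ (permute σ x.1) = x.1
        rw [← permute_mul, inv_mul_cancel, permute_one]
      right_inv := fun x => Subtype.ext <| by
        change permute σ (permute σ⁻¹ x.1) = x.1
        rw [← permute_mul, mul_inv_cancel, permute_one]
      map_rel_iff' := fun {x y} => by
        refine ⟨dl_adj_permute σ⁻¹ ?_ ?_, dl_adj_permute σ rfl rfl⟩
        · change x.1 = permute σ⁻¹ (permute σ x.1)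
          rw [← permute_mul, inv_mul_cancel, permute_one]
        · change y.1 = permute σ⁻¹ (permute σ y.1)
          rw [← permute_mul, inv_mul_cancel, permute_one] }
  map_one' := RelIso.ext fun x => rfl
  map_mul' σ τ := RelIso.ext fun x => Subtype.ext (permute_mul σ τ x.1)

theorem sum_hor_aff (g : affProduct q ω o) (x : DLVertex q ω o) :
    ∑ j, hor (ω (q j)) (o (q j)) ((g.1 j : T (q j) ≃g T (q j)) (x.1 j)) = 0 := by
  obtain ⟨c, hc, hc0⟩ := g.2
  have := Finset.sum_congr rfl fun j (_ : j ∈ Finset.univ) => hc j (x.1 j)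
  rw [Finset.sum_sub_distrib, x.2, hc0, sub_zero] at this
  exact this

/-- The action of the horocyclic product of the affine groups on the Diestel-Leader graph. -/
def affHom : affProduct q ω o →* (DL q ω o ≃g DL q ω o) where
  toFun g :=
    { toFun := fun x => ⟨fun j => (g.1 j : T (q j) ≃g T (q j)) (x.1 j), sum_hor_aff q ω o g x⟩
      invFun := fun x => ⟨fun j => ((g⁻¹).1 j : T (q j) ≃g T (q j)) (x.1 j),
        sum_hor_aff q ω o g⁻¹ x⟩
      left_inv := fun x => Subtype.ext <| funext fun j =>
        (g.1 j : T (q j) ≃g T (q j)).symm_apply_apply _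
      right_inv := fun x => Subtype.ext <| funext fun j =>
        (g.1 j : T (q j) ≃g T (q j)).apply_symm_apply _
      map_rel_iff' := fun {x y} => by
        refine exists_congr fun i => exists_congr fun j => and_congr_right fun _ => ?_
        refine and_congr (g.1 i : T (q i) ≃g T (q i)).map_adj_iff
          (and_congr (g.1 j : T (q j) ≃g T (q j)).map_adj_iff ?_)
        exact forall_congr' fun l => imp_congr_right fun _ => imp_congr_right fun _ =>
          (g.1 l : T (q l) ≃g T (q l)).injective.eq_iff }
  map_one' := RelIso.ext fun x => rfl
  map_mul' g g' := RelIso.ext fun x => rfl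

theorem affHom_permAction (σ : permGroup q) (g : affProduct q ω o) :
    affHom q ω o (permAction q ω o σ g) =
      permHom q ω o σ * affHom q ω o g * (permHom q ω o σ)⁻¹ := by
  rw [eq_mul_inv_iff_mul_eq]
  refine RelIso.ext fun x => Subtype.ext <| funext fun j => ?_
  exact cast_apply (S := fun n => Aff (ω n)) (fun n a v => (a : T n ≃g T n) v) (permGroup_inv σ j)
    (g.1 _) (x.1 _)

/-- The action of the semidirect product on the Diestel-Leader graph. -/
def semidirectHom :
    affProduct q ω o ⋊[permAction q ω o] permGroup q →* (DL q ω o ≃g DL q ω o) :=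
  SemidirectProduct.lift (affHom q ω o) (permHom q ω o) fun σ =>
    MonoidHom.ext fun g => affHom_permAction q ω o σ g

theorem semidirectHom_apply (g : affProduct q ω o) (σ : permGroup q) :
    semidirectHom q ω o ⟨g, σ⟩ = affHom q ω o g * permHom q ω o σ := rfl

end Homs

/-! ### The action is an isomorphism onto the automorphism group -/

section Main

variable {d : ℕ} {q : Fin d → ℕ} {V : ℕ → Type u} {T : ∀ n, SimpleGraph (V n)}
  (hT : ∀ j, (T (q j)).IsTree) (ω : ∀ n, TreeEnd (T n)) (o : ∀ n, V n)

/-- The parent maps of the trees in a Diestel-Leader graph. -/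
noncomputable abbrev parents (q : Fin d → ℕ) (ω : ∀ n, TreeEnd (T n)) : ∀ j, V (q j) → V (q j) :=
  fun j => parent (ω (q j))

include hT

section

variable (H : ∀ j, IsHoroTree (parents q ω j) (hor (ω (q j)) (o (q j))) (q j))
include H

/-- A tree edge changes the height by one and the heights always add up to zero, so of the two
moving coordinates one climbs and the other descends. -/
theorem dl_adj_iff (x y : DLVertex q ω o) :
    (DL q ω o).Adj x y ↔
      ∃ i j, Up (parents q ω) (h := fun j => hor (ω (q j)) (o (q j))) i j x y := by
  constructor
  · rintro ⟨i, j, hij, hi, hj, hk⟩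
    rw [adj_iff_parent (hT i) (ω (q i))] at hi
    rw [adj_iff_parent (hT j) (ω (q j))] at hj
    have hsum : ∑ l, (hor (ω (q l)) (o (q l)) (y.1 l) - hor (ω (q l)) (o (q l)) (x.1 l)) = 0 := by
      rw [Finset.sum_sub_distrib, x.2, y.2, sub_zero]
    rw [Finset.sum_eq_add i j hij (fun l _ hl => by rw [hk l hl.1 hl.2, sub_self])
      (by simp) (by simp)] at hsum
    rcases hi with hi | hi <;> rcases hj with hj | hj
    · have e1 : hor (ω (q i)) (o (q i)) (y.1 i) =
          hor (ω (q i)) (o (q i)) (x.1 i) - 1 :=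
        (congrArg _ hi).trans ((H i).height_parent (x.1 i))
      have e2 : hor (ω (q j)) (o (q j)) (y.1 j) =
          hor (ω (q j)) (o (q j)) (x.1 j) - 1 :=
        (congrArg _ hj).trans ((H j).height_parent (x.1 j))
      omega
    · exact ⟨i, j, hij, hi, hj.symm, fun l h1 h2 => (hk l h1 h2).symm⟩
    · exact ⟨j, i, hij.symm, hj, hi.symm, fun l h1 h2 => (hk l h2 h1).symm⟩
    · have e1 : hor (ω (q i)) (o (q i)) (x.1 i) =
          hor (ω (q i)) (o (q i)) (y.1 i) - 1 :=
        (congrArg _ hi).trans ((H i).height_parent (y.1 i))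
      have e2 : hor (ω (q j)) (o (q j)) (x.1 j) =
          hor (ω (q j)) (o (q j)) (y.1 j) - 1 :=
        (congrArg _ hj).trans ((H j).height_parent (y.1 j))
      omega
  · rintro ⟨i, j, hij, hi, hj, hk⟩
    exact ⟨i, j, hij, (adj_iff_parent (hT i) (ω (q i)) _ _).2 (Or.inl hi),
      (adj_iff_parent (hT j) (ω (q j)) _ _).2 (Or.inr hj.symm), fun l h1 h2 => (hk l h1 h2).symm⟩

omit H in
theorem twist_affHom (g : affProduct q ω o) :
    Twist (h := fun j => hor (ω (q j)) (o (q j))) (parents q ω) (affHom q ω o g) 1 := by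
  rintro i j x y ⟨hij, hi, hj, hk⟩
  have hg : ∀ l v, (g.1 l : T (q l) ≃g T (q l)) (parent (ω (q l)) v) =
      parent (ω (q l)) ((g.1 l : T (q l) ≃g T (q l)) v) :=
    fun l => (mem_aff_iff (hT l) (ω (q l)) _).1 (g.1 l).2
  refine ⟨hij, ?_, ?_, fun l h1 h2 => ?_⟩
  · exact (congrArg (g.1 i : T (q i) ≃g T (q i)) hi).trans (hg i _)
  · exact (hg j _).symm.trans (congrArg (g.1 j : T (q j) ≃g T (q j)) hj)
  · exact congrArg (g.1 l : T (q l) ≃g T (q l)) (hk l h1 h2)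

omit hT H in
theorem twist_permHom (σ : permGroup q) :
    Twist (h := fun j => hor (ω (q j)) (o (q j))) (parents q ω) (permHom q ω o σ) σ := by
  rintro i j x y ⟨hij, hi, hj, hk⟩
  refine ⟨(σ : Equiv.Perm (Fin d)).injective.ne hij, ?_, ?_, fun l h1 h2 => ?_⟩
  · exact (permute_rel_apply (fun n a b => b = parent (ω n) a) σ x.1 y.1 i).2 hi
  · exact (permute_rel_apply (fun n a b => parent (ω n) b = a) σ x.1 y.1 j).2 hj
  · obtain ⟨m, rfl⟩ := (σ : Equiv.Perm (Fin d)).surjective l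
    exact (permute_rel_apply (fun _ a b => b = a) σ x.1 y.1 m).2
      (hk m (fun e => h1 (by rw [e])) (fun e => h2 (by rw [e])))

/-- An automorphism in the image determines `σ` as its twist, and then `g`, because every tree
vertex occurs as a coordinate. Conversely, once the twist is divided out, the coordinate maps
commute with the parent maps and are affine by `mem_aff_iff`. -/
theorem semidirectHom_bijective (hd : 2 ≤ d) (hq : ∀ j, 2 ≤ q j) :
    Function.Bijective (semidirectHom q ω o) := by
  have hG := dl_adj_iff hT ω o H
  constructor
  · rw [injective_iff_map_eq_one]
    rintro ⟨g, σ⟩ e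
    rw [semidirectHom_apply] at e
    have ht : Twist (h := fun j => hor (ω (q j)) (o (q j))) (parents q ω)
        (1 : DL q ω o ≃g DL q ω o) σ := by
      rw [← e]
      exact one_mul (σ : Equiv.Perm (Fin d)) ▸
        (twist_affHom hT ω o g).mul (twist_permHom ω o σ)
    have hσ : σ = 1 := Subtype.ext (ht.unique H hd hq Twist.one)
    subst hσ
    rw [map_one, mul_one] at e
    have hg : g = 1 := by
      refine Subtype.ext <| funext fun j => Subtype.ext <| RelIso.ext fun v => ?_
      obtain ⟨x, hx⟩ := exists_coord H hd hq j v
      have := congrArg (fun φ : DL q ω o ≃g DL q ω o => (φ x).1 j) e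
      change (g.1 j : T (q j) ≃g T (q j)) (x.1 j) = x.1 j at this
      rw [hx] at this
      exact this
    rw [hg]
    rfl
  · intro φ
    obtain ⟨τ, ht, -⟩ := exists_twist hG H hd hq φ
    let σ : permGroup q := ⟨τ, ht.children_eq hG H hd hq⟩
    let ψ : DL q ω o ≃g DL q ω o := φ * (permHom q ω o σ)⁻¹
    have hψ : Twist (h := fun j => hor (ω (q j)) (o (q j))) (parents q ω) ψ 1 := by
      have := ht.mul ((twist_permHom ω o σ).inv hG H hd hq)
      rwa [mul_inv_cancel] at this
    obtain ⟨g, hg, hgp, ginj⟩ : ∃ g : ∀ i, V (q i) → V (q i),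
        (∀ i (x : DLVertex q ω o), (ψ x).1 i = g i (x.1 i)) ∧
        (∀ i v, g i (parent (ω (q i)) v) = parent (ω (q i)) (g i v)) ∧
        ∀ i, Function.Injective (g i) := by
      choose g h1 h2 h3 using hψ.exists_coord_map hG H hd hq
      exact ⟨g, h1, h2, h3⟩
    have gsurj : ∀ i, Function.Surjective (g i) := fun i v => by
      obtain ⟨y, hy⟩ := exists_coord H hd hq i v
      refine ⟨(ψ.symm y).1 i, ?_⟩
      rw [← hg i (ψ.symm y)]
      exact (congrArg (fun z : DLVertex q ω o => z.1 i) (ψ.apply_symm_apply y)).trans hy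
    let e : ∀ i, T (q i) ≃g T (q i) := fun i =>
      ⟨Equiv.ofBijective (g i) ⟨ginj i, gsurj i⟩, fun {a b} => by
        change (T (q i)).Adj (g i a) (g i b) ↔ _
        rw [adj_iff_parent (hT i) (ω (q i)), adj_iff_parent (hT i) (ω (q i))]
        exact or_congr ((Eq.congr_right (hgp i a).symm).trans (ginj i).eq_iff)
          ((Eq.congr_right (hgp i b).symm).trans (ginj i).eq_iff)⟩
    have he : ∀ i, e i ∈ Aff (ω (q i)) := fun i => (mem_aff_iff (hT i) (ω (q i)) _).2 (hgp i)
    have hmem : (fun i => (⟨e i, he i⟩ : Aff (ω (q i)))) ∈ affProduct q ω o := by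
      obtain ⟨x, -⟩ := exists_coord H hd hq ⟨0, by omega⟩ (o _)
      refine ⟨fun i => hor (ω (q i)) (o (q i)) (g i (x.1 i)) - hor (ω (q i)) (o (q i)) (x.1 i),
        fun i v => (H i).shift_eq (H i) (hgp i) v (x.1 i), ?_⟩
      rw [Finset.sum_sub_distrib, x.2, sub_zero]
      refine (Finset.sum_congr rfl fun i _ => ?_).trans (ψ x).2
      rw [← hg i x]
    refine ⟨⟨⟨_, hmem⟩, σ⟩, ?_⟩
    rw [semidirectHom_apply, ← eq_mul_inv_iff_mul_eq]
    exact RelIso.ext fun x => Subtype.ext <| funext fun i => (hg i x).symm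

end

end Main

end DiestelLeader

/-- For every number `n` let `T n` be a graph with a distinguished end `ω n` and origin `o n`; the
ones that matter are the homogeneous trees `T (q j)` of degree `q j + 1`. -/
theorem theorem2p3 {d : ℕ} (hd : 2 ≤ d) (q : Fin d → ℕ) (hq : ∀ j, 2 ≤ q j)
    {V : ℕ → Type*} (T : ∀ n, SimpleGraph (V n))
    (hT : ∀ j, (T (q j)).IsTree)
    (hdeg : ∀ j (v : V (q j)), ((T (q j)).neighborSet v).ncard = q j + 1)
    (ω : ∀ n, DiestelLeader.TreeEnd (T n)) (o : ∀ n, V n) :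
    (∃ Φ : DiestelLeader.affProduct q ω o ⋊[DiestelLeader.permAction q ω o]
          DiestelLeader.permGroup q ≃*
        (DiestelLeader.DL q ω o ≃g DiestelLeader.DL q ω o),
      ∀ (g : DiestelLeader.affProduct q ω o) (σ : DiestelLeader.permGroup q)
        (x : DiestelLeader.DLVertex q ω o) (j : Fin d),
        (Φ ⟨g, σ⟩ x).1 j =
          (g.1 j : T (q j) ≃g T (q j)) (DiestelLeader.permute (F := V) σ x.1 j)) ∧
    IsTopologicalGroup (DiestelLeader.DL q ω o ≃g DiestelLeader.DL q ω o) ∧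
    LocallyCompactSpace (DiestelLeader.DL q ω o ≃g DiestelLeader.DL q ω o) ∧
    DiestelLeader.IsAmenableGroup (DiestelLeader.DL q ω o ≃g DiestelLeader.DL q ω o) ∧
    (DiestelLeader.IsUnimodularGroup (DiestelLeader.DL q ω o ≃g DiestelLeader.DL q ω o) ↔
      ∀ i j, q i = q j) := by
  have H := fun j => DiestelLeader.isHoroTree_of_isTree (hT j) (ω (q j)) (o (q j)) (hdeg j)
  have hG := DiestelLeader.dl_adj_iff hT ω o H
  obtain ⟨x, -⟩ := DiestelLeader.exists_coord H hd hq ⟨0, by omega⟩ (o _)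
  have : Nonempty (DiestelLeader.DLVertex q ω o) := ⟨x⟩
  refine ⟨⟨MulEquiv.ofBijective (DiestelLeader.semidirectHom q ω o)
    (DiestelLeader.semidirectHom_bijective hT ω o H hd hq), fun g σ x j => rfl⟩,
    DiestelLeader.isTopologicalGroup_aut, ?_, ?_, ?_⟩
  · exact DiestelLeader.locallyCompactSpace_aut (DiestelLeader.hprod_preconnected hG H hd hq)
      (DiestelLeader.hprod_neighborSet_finite hG H hq)
  · exact DiestelLeader.isAmenableGroup_hprod H hq hd hG
  · exact DiestelLeader.isUnimodularGroup_hprod hG H hd hq
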